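/- Let $d\in\mathbb N$, $1\le\alpha<2$. Let $M:\mathbb R^d\to\mathbb R$ be twice differentiable with $M>0$, $M(-v)=M(v)$, $\int_{\mathbb R^d} M\,dv=1$, $|v|^{d+\alpha}M(v)\to\gamma$ as $|v|\to\infty$ for some $\gamma>0$, and $|D_vM(v)|\le C\frac{M(v)}{1+|v|}$, $|D_v^2M(v)|\le C\,M(v)$ for all $v$. Let $\sigma:\mathbb R^d\times\mathbb R^d\to\mathbb R$ be differentiable in each variable, with $\sigma(v,v')=\sigma(v',v)$, $0<\nu_1\le\sigma(v,v')\le\nu_2$, $|\nabla_v\sigma(v',v)|\le\frac{C}{1+|v|}$ and $|\sigma(v,v')-\nu_0|\le\frac{C}{1+|v|}$ for all $v,v'$ and some constants $C,\nu_0,\nu_1,\nu_2$; assume also that $\nu(v)=\int_{\mathbb R^d}\sigma(v',v)M(v')\,dv'$ is even. Put $$Q(f)(v)=\int_{\mathbb R^d}\big(\sigma(v,v')M(v)f(v')-\sigma(v',v)M(v')f(v)\big)\,dv',\qquad \|f\|_{L^2_{M^{-1}}}=\Big(\int_{\mathbb R^d}|f(v)|^2\,\frac{dv}{M(v)}\Big)^{1/2},$$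 where $Q$ acts componentwise on vector fields. (a) For every $E\in\mathbb R^d$ there is a unique $F(\cdot,E)\in L^2_{M^{-1}}(\mathbb R^d)$ that satisfies $E\cdot\nabla_vF-Q(F)=0$ in the sense of distributions and $\int_{\mathbb R^d}F(v,E)\,dv=1$. It has a continuous representative, which is positive everywhere; $F(\cdot,E)$ denotes this representative. (b) There is a unique $\lambda\in(L^2_{M^{-1}}(\mathbb R^d))^d$ with $Q(\lambda)=\nabla_vM$ almost everywhere and $\int_{\mathbb R^d}\lambda\,dv=0$; it has a representative for which $Q(\lambda)(v)=\nabla_vM(v)$ at every $v$, and $\lambda$ denotes this representative. (c) Define $G$ by $$F(v,E)=M(v)+E\cdot\lambda(v)+G(v,E).$$ There is a constant $C>0$, independent of $E$ and $v$, such that for all $|E|\le1$ $$\|G(\cdot,E)\|_{L^2_{M^{-1}}(\mathbb R^d)}\le C|E|^2,\qquad |G(v,E)|\le C|E|^2M(v)\quad\text{for all }v\in\mathbb R^d.$$ -/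

import Mathlib

open MeasureTheory Filter Topology
open scoped ContDiff

/-- The collision frequency `ν(v) = ∫ σ(v', v) M(v') dv'`. -/
noncomputable def collisionFreq {d : ℕ}
    (σ : EuclideanSpace ℝ (Fin d) → EuclideanSpace ℝ (Fin d) → ℝ)
    (M : EuclideanSpace ℝ (Fin d) → ℝ) (v : EuclideanSpace ℝ (Fin d)) : ℝ :=
  ∫ v', σ v' v * M v'

/-- The linear Boltzmann operator
`Q(f)(v) = ∫ (σ(v, v') M(v) f(v') - σ(v', v) M(v') f(v)) dv'`,
for scalar functions `f` (`H = ℝ`) and, componentwise, for vector fields. -/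
noncomputable def boltzmannQ {d : ℕ} {H : Type*} [NormedAddCommGroup H] [NormedSpace ℝ H]
    (σ : EuclideanSpace ℝ (Fin d) → EuclideanSpace ℝ (Fin d) → ℝ)
    (M : EuclideanSpace ℝ (Fin d) → ℝ) (f : EuclideanSpace ℝ (Fin d) → H)
    (v : EuclideanSpace ℝ (Fin d)) : H :=
  ∫ v', ((σ v v' * M v) • f v' - (σ v' v * M v') • f v)

/-- The measure `dv / M(v)`; the space `L²_{M⁻¹}(ℝᵈ)` is the `L²` space of this measure. -/
noncomputable def invWeight {d : ℕ} (M : EuclideanSpace ℝ (Fin d) → ℝ) :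
    Measure (EuclideanSpace ℝ (Fin d)) :=
  volume.withDensity (fun v => ENNReal.ofReal ((M v)⁻¹))

/-- Assumptions on the thermodynamical equilibrium `M`: a positive, even probability density,
with a heavy tail of exponent `d + α`, `1 ≤ α < 2`, twice differentiable, with
`|DM| ≤ C M / (1 + |v|)` and `|D²M| ≤ C M`. -/
structure HeavyTailEquilibrium {d : ℕ} (α : ℝ) (M : EuclideanSpace ℝ (Fin d) → ℝ) : Prop where
  one_le_alpha : 1 ≤ α
  alpha_lt_two : α < 2
  pos : ∀ v, 0 < M v
  even : ∀ v, M (-v) = M v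
  integral_eq_one : ∫ v, M v = 1
  tail : ∃ γ : ℝ, 0 < γ ∧
    Tendsto (fun v => ‖v‖ ^ ((d : ℝ) + α) * M v)
      (Bornology.cobounded (EuclideanSpace ℝ (Fin d))) (𝓝 γ)
  differentiable : Differentiable ℝ M
  differentiable_fderiv : Differentiable ℝ (fderiv ℝ M)
  fderiv_bound : ∃ C : ℝ, ∀ v, ‖fderiv ℝ M v‖ ≤ C * (M v / (1 + ‖v‖))
  fderiv_fderiv_bound : ∃ C : ℝ, ∀ v, ‖fderiv ℝ (fderiv ℝ M) v‖ ≤ C * M v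

/-- Assumptions on the cross section `σ`: symmetric, bounded between two positive constants,
differentiable in each variable with `|∇_v σ(v', v)| ≤ C / (1 + |v|)`, with an even collision
frequency, and with `|σ(v, v') - ν₀| ≤ C / (1 + |v|)` for some `ν₀`. -/
structure AdmissibleCrossSection {d : ℕ} (M : EuclideanSpace ℝ (Fin d) → ℝ)
    (σ : EuclideanSpace ℝ (Fin d) → EuclideanSpace ℝ (Fin d) → ℝ) : Prop where
  symm : ∀ v v', σ v v' = σ v' v
  bounds : ∃ ν₁ ν₂ : ℝ, 0 < ν₁ ∧ ∀ v v', ν₁ ≤ σ v v' ∧ σ v v' ≤ ν₂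
  differentiable : ∀ v', Differentiable ℝ (fun v => σ v' v)
  fderiv_bound : ∃ C : ℝ, ∀ v' v, ‖fderiv ℝ (fun w => σ v' w) v‖ ≤ C / (1 + ‖v‖)
  freq_even : ∀ v, collisionFreq σ M (-v) = collisionFreq σ M v
  limit : ∃ ν₀ C : ℝ, ∀ v v', |σ v v' - ν₀| ≤ C / (1 + ‖v‖)

/-- `f ∈ L²_{M⁻¹}(ℝᵈ)` solves `E · ∇f - Q(f) = 0` in the sense of distributions, with unit mass.
(As `Q(f) ∈ L²_{M⁻¹}`, such an `f` has its distributional derivative `E · ∇f` in `L²_{M⁻¹}`.) -/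
structure IsModifiedEquilibrium {d : ℕ}
    (σ : EuclideanSpace ℝ (Fin d) → EuclideanSpace ℝ (Fin d) → ℝ)
    (M : EuclideanSpace ℝ (Fin d) → ℝ) (E : EuclideanSpace ℝ (Fin d))
    (f : EuclideanSpace ℝ (Fin d) → ℝ) : Prop where
  memLp : MemLp f 2 (invWeight M)
  weak_eq : ∀ φ : EuclideanSpace ℝ (Fin d) → ℝ, ContDiff ℝ ∞ φ → HasCompactSupport φ →
    -∫ v, f v * fderiv ℝ φ v E = ∫ v, boltzmannQ σ M f v * φ v
  mass : ∫ v, f v = 1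

/-!
Split `σ = δ + k` with `δ > 0` constant and `k ≥ 0`. On functions of mass `m` the equation
`E · ∇f = Q(f)` becomes `E · ∇f + ν f = M (δ m + k f)`. Since `|∇M| ≤ C M / (1 + |v|)`, the weight
`M` grows slower than any exponential, so `E · ∇ + ν` can be inverted by integration along lines,
uniformly for bounded `E` and within the functions bounded by a multiple of `M`.

Conservation of mass makes `k (E · ∇ + ν)⁻¹ M` a contraction for the seminorm `∫ M |b|`, and it maps
this seminorm into the sup norm, which gives existence. For a source `h` with `|h| ≤ κ M`, the same
balance yields `δ ∫ |f| ≤ κ`. With `κ = 0` this is uniqueness; with `κ = δ` and `∫ f = 1` it forces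
`f ≥ 0`; and the remainder `G` solves this equation with source `-⟨E, Dλ E⟩`, where `|Dλ| ≤ B M`, so
that `κ = B |E|²`, from which the inverse of `E · ∇ + ν` recovers the pointwise bound.
-/

section Dominated

variable {X : Type*} [TopologicalSpace X] {H : Type*} [NormedAddCommGroup H] {M : X → ℝ}

/-- Continuous functions `g` with `‖g‖ ≤ B M` for some constant `B`: the class in which the
transport equations below are solved. -/
structure IsDominated (M : X → ℝ) (g : X → H) : Prop where
  continuous : Continuous g
  bound : ∃ B, ∀ v, ‖g v‖ ≤ B * M v

namespace IsDominated

variable {g g' : X → H}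

theorem norm (hg : IsDominated M g) : IsDominated M fun v => ‖g v‖ :=
  ⟨hg.continuous.norm, by simpa only [norm_norm] using hg.bound⟩

theorem sub (hg : IsDominated M g) (hg' : IsDominated M g') :
    IsDominated M fun v => g v - g' v := by
  obtain ⟨B, hB⟩ := hg.bound
  obtain ⟨B', hB'⟩ := hg'.bound
  exact ⟨hg.continuous.sub hg'.continuous, B + B', fun v =>
    (norm_sub_le _ _).trans ((add_le_add (hB v) (hB' v)).trans_eq (add_mul _ _ _).symm)⟩

theorem comp_continuousLinearMap [NormedSpace ℝ H] {K : Type*} [NormedAddCommGroup K]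
    [NormedSpace ℝ K] (L : H →L[ℝ] K) (hg : IsDominated M g) : IsDominated M fun v => L (g v) := by
  obtain ⟨B, hB⟩ := hg.bound
  refine ⟨L.continuous.comp hg.continuous, ‖L‖ * B, fun v => ?_⟩
  rw [mul_assoc]
  exact L.le_opNorm_of_le (hB v)

theorem smul_of_bounded [NormedSpace ℝ H] {a : X → ℝ} {B : ℝ} (ha : Continuous a)
    (haB : ∀ v, |a v| ≤ B) (hg : IsDominated M g) : IsDominated M fun v => a v • g v := by
  obtain ⟨B', hB'⟩ := hg.bound
  refine ⟨ha.smul hg.continuous, B * B', fun v => ?_⟩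
  rw [norm_smul, Real.norm_eq_abs, mul_assoc]
  exact mul_le_mul (haB v) (hB' v) (norm_nonneg _) ((abs_nonneg _).trans (haB v))

theorem integrable [MeasurableSpace X] [BorelSpace X] [SecondCountableTopologyEither X H]
    {μ : Measure X} (hM : Integrable M μ) (hg : IsDominated M g) : Integrable g μ := by
  obtain ⟨B, hB⟩ := hg.bound
  exact (hM.const_mul B).mono' hg.continuous.aestronglyMeasurable (Eventually.of_forall hB)

end IsDominated

end Dominated

section Transport

variable {V : Type*} [NormedAddCommGroup V] [NormedSpace ℝ V]
  {H : Type*} [NormedAddCommGroup H] [NormedSpace ℝ H]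

/-- The integral `∫₀ˣ ν(v + τE) dτ` of the frequency `ν` along the line through `v` directed
by `E`; its exponential is the integrating factor of `E · ∇ + ν`. -/
noncomputable def opticalDepth (ν : V → ℝ) (E v : V) (x : ℝ) : ℝ :=
  ∫ τ in (0 : ℝ)..x, ν (v + τ • E)

/-- The operator `(E · ∇ + ν)⁻¹`, by integration along the half-lines directed by `-E`. -/
noncomputable def transportInv (ν : V → ℝ) (E : V) (g : V → H) (v : V) : H :=
  ∫ x in Set.Iic (0 : ℝ), Real.exp (opticalDepth ν E v x) • g (v + x • E)

/-- The classical transport equation `E · ∇f + ν f = g`, where `f` need only be differentiable in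
the direction `E`. -/
def SolvesTransport (ν : V → ℝ) (E : V) (f g : V → H) : Prop :=
  ∀ v, HasLineDerivAt ℝ f (g v - ν v • f v) v E

theorem hasDerivAt_comp_line {f f' : V → H} {E : V} (hf : ∀ v, HasLineDerivAt ℝ f (f' v) v E)
    (v : V) (t : ℝ) : HasDerivAt (fun s : ℝ => f (v + s • E)) (f' (v + t • E)) t := by
  have hline : HasDerivAt (fun s : ℝ => f (v + t • E + s • E)) (f' (v + t • E)) (t - t) := by
    rw [sub_self]
    exact hf (v + t • E)
  refine (hline.comp_sub_const t t).congr_of_eventuallyEq (Eventually.of_forall fun s => ?_)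
  simp only [sub_smul]
  congr 1
  abel

theorem SolvesTransport.sub {ν : V → ℝ} {E : V} {f f' g g' : V → H}
    (hf : SolvesTransport ν E f g) (hf' : SolvesTransport ν E f' g') :
    SolvesTransport ν E (fun v => f v - f' v) fun v => g v - g' v := fun v => by
  refine HasDerivAt.congr_deriv (HasDerivAt.sub (hf v) (hf' v)) ?_
  module

section OpticalDepth

variable {ν : V → ℝ} (E v : V)

theorem opticalDepth_zero (ν : V → ℝ) : opticalDepth ν E v 0 = 0 :=
  intervalIntegral.integral_same

variable (hν : Continuous ν)
include hν

theorem hasDerivAt_opticalDepth (x : ℝ) : HasDerivAt (opticalDepth ν E v) (ν (v + x • E)) x := by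
  have hc : Continuous fun τ : ℝ => ν (v + τ • E) := by fun_prop
  exact intervalIntegral.integral_hasDerivAt_right (hc.intervalIntegrable _ _)
    (hc.stronglyMeasurableAtFilter _ _) hc.continuousAt

theorem continuous_opticalDepth : Continuous (opticalDepth ν E v) :=
  continuous_iff_continuousAt.2 fun x => (hasDerivAt_opticalDepth E v hν x).continuousAt

omit v in
theorem continuous_opticalDepth_left (x : ℝ) : Continuous fun v => opticalDepth ν E v x :=
  intervalIntegral.continuous_parametric_intervalIntegral_of_continuous
    (f := fun (v : V) (τ : ℝ) => ν (v + τ • E))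
    (show Continuous fun p : V × ℝ => ν (p.1 + p.2 • E) by fun_prop) continuous_const

theorem opticalDepth_add_smul (t x : ℝ) :
    opticalDepth ν E (v + t • E) x = opticalDepth ν E v (x + t) - opticalDepth ν E v t := by
  have hc : Continuous fun τ : ℝ => ν (v + τ • E) := by fun_prop
  have hshift : opticalDepth ν E (v + t • E) x =
      ∫ τ in (0 : ℝ)..x, (fun τ => ν (v + τ • E)) (τ + t) := by
    refine intervalIntegral.integral_congr fun τ _ => ?_
    simp only [add_smul]
    congr 1
    abel
  rw [hshift, intervalIntegral.integral_comp_add_right (fun τ => ν (v + τ • E)), zero_add,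
    opticalDepth, opticalDepth, intervalIntegral.integral_interval_sub_left
      (hc.intervalIntegrable _ _) (hc.intervalIntegrable _ _)]

theorem opticalDepth_le {c : ℝ} (hc : ∀ v, c ≤ ν v) {x : ℝ} (hx : x ≤ 0) :
    opticalDepth ν E v x ≤ c * x := by
  have hcont : Continuous fun τ : ℝ => ν (v + τ • E) := by fun_prop
  have hmono := intervalIntegral.integral_mono_on (μ := volume) hx
    (continuous_const.intervalIntegrable x 0) (hcont.intervalIntegrable x 0)
    fun τ _ => hc (v + τ • E)
  rw [intervalIntegral.integral_const, smul_eq_mul] at hmono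
  rw [opticalDepth, intervalIntegral.integral_symm]
  linarith

end OpticalDepth

theorem SolvesTransport.hasDerivAt_exp_opticalDepth_smul {ν : V → ℝ} {E : V}
    {f h : V → H} (hf : SolvesTransport ν E f h) (hν : Continuous ν) (v : V) (x : ℝ) :
    HasDerivAt (fun x => Real.exp (opticalDepth ν E v x) • f (v + x • E))
      (Real.exp (opticalDepth ν E v x) • h (v + x • E)) x := by
  refine HasDerivAt.congr_deriv ((hasDerivAt_opticalDepth E v hν x).exp.smul
    (hasDerivAt_comp_line hf v x)) ?_
  module

/-- A frequency `ν ≥ 2c > 0` and a weight `M` that grows at most at the rate `c` backwards along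
the lines directed by `E`: the setting in which `E · ∇ + ν` can be inverted. -/
structure DampedTransport (ν M : V → ℝ) (E : V) (c A : ℝ) : Prop where
  continuous_freq : Continuous ν
  continuous_weight : Continuous M
  rate_pos : 0 < c
  le_freq : ∀ v, 2 * c ≤ ν v
  weight_pos : ∀ v, 0 < M v
  growth : ∀ v, ∀ x ≤ (0 : ℝ), M (v + x • E) ≤ A * Real.exp (-(c * x)) * M v

theorem transportInv_add_smul {ν : V → ℝ} (hν : Continuous ν) (E : V) (g : V → H) (v : V)
    (t : ℝ) :
    transportInv ν E g (v + t • E) = Real.exp (-opticalDepth ν E v t) •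
      ∫ x in Set.Iic t, Real.exp (opticalDepth ν E v x) • g (v + x • E) := by
  have hshift := (measurePreserving_add_right (volume : Measure ℝ) t).setIntegral_preimage_emb
    (measurableEmbedding_addRight t)
    (fun x => Real.exp (-opticalDepth ν E v t) • Real.exp (opticalDepth ν E v x) • g (v + x • E))
    (Set.Iic t)
  rw [Set.preimage_add_const_Iic, sub_self] at hshift
  rw [← integral_smul, ← hshift, transportInv]
  congr 1
  funext x
  rw [opticalDepth_add_smul E v hν, smul_smul, ← Real.exp_add]
  congr 2
  · ring
  · rw [add_smul]
    abel

namespace DampedTransport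

variable {ν M : V → ℝ} {E : V} {c A : ℝ} (D : DampedTransport ν M E c A)
include D

theorem exp_mul_weight_le (v : V) {x : ℝ} (hx : x ≤ 0) :
    Real.exp (opticalDepth ν E v x) * M (v + x • E) ≤ A * M v * Real.exp (c * x) := by
  have hdepth : Real.exp (opticalDepth ν E v x) ≤ Real.exp (2 * c * x) :=
    Real.exp_le_exp.2 (opticalDepth_le E v D.continuous_freq D.le_freq hx)
  have hweight := (D.weight_pos (v + x • E)).le
  calc Real.exp (opticalDepth ν E v x) * M (v + x • E)
      ≤ Real.exp (2 * c * x) * (A * Real.exp (-(c * x)) * M v) :=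
        mul_le_mul hdepth (D.growth v x hx) hweight (Real.exp_pos _).le
    _ = A * M v * (Real.exp (2 * c * x) * Real.exp (-(c * x))) := by ring
    _ = A * M v * Real.exp (c * x) := by
        rw [← Real.exp_add]
        ring_nf

variable {g g' : V → H} {B B' : ℝ}

theorem norm_integrand_le (hgM : ∀ v, ‖g v‖ ≤ B * M v) (v : V) {x : ℝ} (hx : x ≤ 0) :
    ‖Real.exp (opticalDepth ν E v x) • g (v + x • E)‖ ≤ B * A * M v * Real.exp (c * x) := by
  have hB : 0 ≤ B :=
    nonneg_of_mul_nonneg_left ((norm_nonneg _).trans (hgM 0)) (D.weight_pos 0)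
  rw [norm_smul, Real.norm_eq_abs, Real.abs_exp]
  calc Real.exp (opticalDepth ν E v x) * ‖g (v + x • E)‖
      ≤ Real.exp (opticalDepth ν E v x) * (B * M (v + x • E)) := by
        gcongr
        exact hgM _
    _ = B * (Real.exp (opticalDepth ν E v x) * M (v + x • E)) := by ring
    _ ≤ B * (A * M v * Real.exp (c * x)) :=
        mul_le_mul_of_nonneg_left (D.exp_mul_weight_le v hx) hB
    _ = B * A * M v * Real.exp (c * x) := by ring

theorem continuous_integrand (hg : Continuous g) (v : V) :
    Continuous fun x : ℝ => Real.exp (opticalDepth ν E v x) • g (v + x • E) := by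
  have := continuous_opticalDepth E v D.continuous_freq
  fun_prop

theorem integrableOn_integrand (hg : IsDominated M g) (v : V) (t : ℝ) :
    IntegrableOn (fun x : ℝ => Real.exp (opticalDepth ν E v x) • g (v + x • E)) (Set.Iic t) := by
  have hc := D.continuous_integrand hg.continuous v
  obtain ⟨B, hB⟩ := hg.bound
  have hzero : IntegrableOn (fun x : ℝ => Real.exp (opticalDepth ν E v x) • g (v + x • E))
      (Set.Iic 0) :=
    Integrable.mono' ((integrableOn_exp_mul_Iic D.rate_pos 0).const_mul (B * A * M v))
      hc.aestronglyMeasurable <| (ae_restrict_iff' measurableSet_Iic).2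
        (Eventually.of_forall fun x hx => D.norm_integrand_le hB v hx)
  rcases le_total t 0 with ht | ht
  · exact hzero.mono_set (Set.Iic_subset_Iic.2 ht)
  · rw [← Set.Iic_union_Icc_eq_Iic ht]
    exact hzero.union hc.continuousOn.integrableOn_Icc

theorem norm_transportInv_le_mul (hgM : ∀ v, ‖g v‖ ≤ B * M v) (v : V) :
    ‖transportInv ν E g v‖ ≤ B * A / c * M v := by
  have hbound := norm_integral_le_of_norm_le
    ((integrableOn_exp_mul_Iic D.rate_pos 0).const_mul (B * A * M v))
    ((ae_restrict_iff' measurableSet_Iic).2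
      (Eventually.of_forall fun x hx => D.norm_integrand_le hgM v hx))
  rw [integral_const_mul, integral_exp_mul_Iic D.rate_pos, mul_zero, Real.exp_zero] at hbound
  exact hbound.trans_eq (by ring)

theorem continuous_transportInv (hg : IsDominated M g) : Continuous (transportInv ν E g) := by
  obtain ⟨B, hB⟩ := hg.bound
  refine continuous_iff_continuousAt.2 fun v₀ => ?_
  have hlocal : ∀ᶠ v in 𝓝 v₀, B * A * M v ≤ B * A * M v₀ + 1 :=
    (((D.continuous_weight.const_mul (B * A)).tendsto v₀).eventually_lt_const
      (lt_add_one _)).mono fun _ => le_of_lt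
  refine continuousAt_of_dominated (bound := fun x => (B * A * M v₀ + 1) * Real.exp (c * x))
    (Eventually.of_forall fun v => (D.continuous_integrand hg.continuous v).aestronglyMeasurable)
    ?_ ((integrableOn_exp_mul_Iic D.rate_pos 0).const_mul _) (Eventually.of_forall fun x => ?_)
  · filter_upwards [hlocal] with v hv
    refine (ae_restrict_iff' measurableSet_Iic).2
      (Eventually.of_forall fun x hx => (D.norm_integrand_le hB v hx).trans ?_)
    gcongr
  · have hdepth := continuous_opticalDepth_left E D.continuous_freq x
    have hgc := hg.continuous
    exact Continuous.continuousAt (by fun_prop)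

theorem isDominated_transportInv (hg : IsDominated M g) : IsDominated M (transportInv ν E g) := by
  obtain ⟨B, hB⟩ := hg.bound
  exact ⟨D.continuous_transportInv hg, _, D.norm_transportInv_le_mul hB⟩

theorem transportInv_sub (hg : IsDominated M g) (hg' : IsDominated M g') (v : V) :
    transportInv ν E (fun w => g w - g' w) v = transportInv ν E g v - transportInv ν E g' v := by
  rw [transportInv, transportInv, transportInv, ← integral_sub
    (D.integrableOn_integrand hg v 0) (D.integrableOn_integrand hg' v 0)]
  simp only [smul_sub]

theorem transportInv_pos {g : V → ℝ} (hg : IsDominated M g) (hpos : ∀ v, 0 < g v) (v : V) :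
    0 < transportInv ν E g v := by
  have hintegrand : ∀ x, 0 < Real.exp (opticalDepth ν E v x) • g (v + x • E) := fun x =>
    smul_pos (Real.exp_pos _) (hpos _)
  have hsupport :
      Function.support (fun x => Real.exp (opticalDepth ν E v x) • g (v + x • E)) = Set.univ :=
    Set.eq_univ_of_forall fun x => (hintegrand x).ne'
  refine (setIntegral_pos_iff_support_of_nonneg_ae
    (Eventually.of_forall fun x => (hintegrand x).le) (D.integrableOn_integrand hg v 0)).2 ?_
  rw [hsupport]
  simp

theorem solvesTransport_transportInv [CompleteSpace H] (hg : IsDominated M g) :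
    SolvesTransport ν E (transportInv ν E g) g := fun v => by
  have hc := D.continuous_integrand hg.continuous v
  have hint := D.integrableOn_integrand hg v
  have hprimitive : HasDerivAt (fun t => ∫ x in Set.Iic t,
      Real.exp (opticalDepth ν E v x) • g (v + x • E)) (g v) 0 := by
    have hinterval := intervalIntegral.integral_hasDerivAt_right (hc.intervalIntegrable 0 0)
      (hc.stronglyMeasurableAtFilter _ _) hc.continuousAt
    simp only [opticalDepth_zero, Real.exp_zero, zero_smul, add_zero, one_smul] at hinterval
    refine (hinterval.add_const (transportInv ν E g v)).congr_of_eventuallyEq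
      (Eventually.of_forall fun t => ?_)
    simp only [transportInv]
    rw [← intervalIntegral.integral_Iic_sub_Iic (hint 0) (hint t)]
    abel
  have hfactor : HasDerivAt (fun t => Real.exp (-opticalDepth ν E v t)) (-ν v) 0 := by
    simpa [opticalDepth_zero] using (hasDerivAt_opticalDepth E v D.continuous_freq 0).neg.exp
  have hprod := hfactor.smul hprimitive
  simp only [opticalDepth_zero, neg_zero, Real.exp_zero, one_smul, neg_smul] at hprod
  refine (hprod.congr_deriv ?_).congr_of_eventuallyEq
    (Eventually.of_forall fun t => transportInv_add_smul D.continuous_freq E g v t)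
  rw [sub_eq_add_neg]
  rfl

theorem tendsto_exp_opticalDepth_smul_atBot (hg : IsDominated M g) (v : V) :
    Tendsto (fun x : ℝ => Real.exp (opticalDepth ν E v x) • g (v + x • E)) atBot (𝓝 0) := by
  obtain ⟨B, hB⟩ := hg.bound
  have hexp : Tendsto (fun x : ℝ => B * A * M v * Real.exp (c * x)) atBot (𝓝 0) := by
    simpa using (Real.tendsto_exp_atBot.comp
      (tendsto_id.const_mul_atBot D.rate_pos)).const_mul (B * A * M v)
  refine squeeze_zero_norm' ?_ hexp
  filter_upwards [eventually_le_atBot 0] with x hx using D.norm_integrand_le hB v hx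

theorem norm_le_transportInv {f h : V → H} {g : V → ℝ} (hf : SolvesTransport ν E f h)
    (hfM : IsDominated M f) (hg : IsDominated M g) (hhg : ∀ v, ‖h v‖ ≤ g v) (v : V) :
    ‖f v‖ ≤ transportInv ν E g v := by
  have hder := hf.hasDerivAt_exp_opticalDepth_smul D.continuous_freq v
  have hleft := ((D.tendsto_exp_opticalDepth_smul_atBot hfM v).const_sub (f v)).norm
  rw [sub_zero] at hleft
  have hright := intervalIntegral_tendsto_integral_Iic (0 : ℝ) (D.integrableOn_integrand hg v 0)
    (tendsto_id (α := ℝ) (x := atBot))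
  refine le_of_tendsto_of_tendsto hleft hright ?_
  filter_upwards [eventually_le_atBot 0] with x hx
  have hincr := norm_sub_le_integral_of_norm_deriv_le_of_le hx
    (f := fun x => Real.exp (opticalDepth ν E v x) • f (v + x • E))
    (B := fun x => Real.exp (opticalDepth ν E v x) • g (v + x • E))
    (fun x _ => (hder x).continuousAt.continuousWithinAt)
    (fun x _ => (hder x).differentiableAt.differentiableWithinAt)
    (Eventually.of_forall fun x _ => by
      rw [(hder x).deriv, norm_smul, Real.norm_eq_abs, Real.abs_exp, smul_eq_mul]
      gcongr
      exact hhg _)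
    ((D.continuous_integrand hg.continuous v).intervalIntegrable _ _)
  simpa [opticalDepth_zero] using hincr

theorem eq_transportInv [CompleteSpace H] {f h : V → H} (hf : SolvesTransport ν E f h)
    (hfM : IsDominated M f) (hh : IsDominated M h) : f = transportInv ν E h := by
  funext v
  have hdiff := D.norm_le_transportInv (g := fun _ => 0)
    (hf.sub (D.solvesTransport_transportInv hh)) (hfM.sub (D.isDominated_transportInv hh))
    ⟨continuous_const, 0, by simp⟩ (by simp) v
  simpa [transportInv, sub_eq_zero] using hdiff

end DampedTransport

section Integral

variable [MeasurableSpace V] [BorelSpace V] [FiniteDimensional ℝ V]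
  {μ : Measure V} [μ.IsAddHaarMeasure]

theorem integral_lineDeriv_eq_zero {f f' : V → H} {E : V}
    (hf : ∀ v, HasLineDerivAt ℝ f (f' v) v E) (hfi : Integrable f μ) (hfi' : Integrable f' μ) :
    ∫ v, f' v ∂μ = 0 := by
  simpa using integral_bilinear_hasLineDerivAt_right_eq_neg_left_of_integrable (μ := μ)
    (f := fun _ : V => (1 : ℝ)) (f' := fun _ => 0) (g := f) (g' := f') (v := E)
    (B := ContinuousLinearMap.lsmul ℝ ℝ)
    (by simp) (by simpa using hfi') (by simpa using hfi)
    (fun x _ => by simpa [HasLineDerivAt] using hasDerivAt_const (0 : ℝ) (1 : ℝ))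
    (fun x _ => hf x)

theorem SolvesTransport.integral_freq_smul_eq {ν : V → ℝ} {E : V} {f h : V → H}
    (hf : SolvesTransport ν E f h) (hfi : Integrable f μ)
    (hνf : Integrable (fun v => ν v • f v) μ) (hh : Integrable h μ) :
    ∫ v, ν v • f v ∂μ = ∫ v, h v ∂μ := by
  have hzero := integral_lineDeriv_eq_zero hf hfi (hh.sub hνf)
  rw [integral_sub hh hνf] at hzero
  exact (sub_eq_zero.1 hzero).symm

end Integral

end Transport

section Kernel

open scoped BoundedContinuousFunction

variable {X : Type*} [MeasurableSpace X] {μ : Measure X}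
  {H : Type*} [NormedAddCommGroup H] [NormedSpace ℝ H]

/-- The integral operator `f ↦ ∫ k(v, v') f(v') dμ(v')` with kernel `k`. -/
noncomputable def kernelIntegral (μ : Measure X) (k : X → X → ℝ) (f : X → H) (v : X) : H :=
  ∫ v', k v v' • f v' ∂μ

/-- The collision frequency `δ + ∫ k(v, v') M(v') dμ(v')` of the cross section `δ + k`, when `M`
has unit mass. -/
noncomputable def relaxationFreq (μ : Measure X) (k : X → X → ℝ) (M : X → ℝ) (δ : ℝ) (v : X) : ℝ :=
  δ + kernelIntegral μ k M v

/-- A positive constant `δ` and a continuous symmetric kernel `0 ≤ k ≤ β`, together with a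
continuous positive probability density `M`. They stand for the Doeblin splitting `σ = δ + k` of a
cross section that is bounded below by `δ`: the part `δ` of the scattering forgets the incoming
velocity. -/
structure ExcessKernel [TopologicalSpace X] (μ : Measure X) (k : X → X → ℝ) (M : X → ℝ)
    (δ β : ℝ) : Prop where
  continuous_kernel : Continuous (Function.uncurry k)
  symm : ∀ v v', k v v' = k v' v
  nonneg : ∀ v v', 0 ≤ k v v'
  le : ∀ v v', k v v' ≤ β
  rate_pos : 0 < δ
  continuous_weight : Continuous M
  weight_pos : ∀ v, 0 < M v
  integral_weight : ∫ v, M v ∂μ = 1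

namespace ExcessKernel

variable [TopologicalSpace X] {k : X → X → ℝ} {M : X → ℝ} {δ β : ℝ} (K : ExcessKernel μ k M δ β)
include K

theorem integrable_weight : Integrable M μ := integrable_of_integral_eq_one K.integral_weight

theorem upper_nonneg : 0 ≤ β := by
  rcases isEmpty_or_nonempty X with hX | ⟨⟨v⟩⟩
  · simpa [μ.eq_zero_of_isEmpty] using K.integral_weight
  · exact (K.nonneg v v).trans (K.le v v)

theorem norm_kernel_le (v v' : X) : ‖k v v'‖ ≤ β := by
  rw [Real.norm_eq_abs, abs_of_nonneg (K.nonneg v v')]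
  exact K.le v v'

theorem isDominated_weight_smul {b : X → H} {B : ℝ} (hb : Continuous b) (hbB : ∀ v, ‖b v‖ ≤ B) :
    IsDominated M fun v => M v • b v := by
  refine ⟨K.continuous_weight.smul hb, B, fun v => ?_⟩
  rw [norm_smul, Real.norm_eq_abs, abs_of_pos (K.weight_pos v), mul_comm]
  exact mul_le_mul_of_nonneg_right (hbB v) (K.weight_pos v).le

theorem norm_kernelIntegral_le (f : X → H) (v : X) :
    ‖kernelIntegral μ k f v‖ ≤ kernelIntegral μ k (fun w => ‖f w‖) v := by
  refine (norm_integral_le_integral_norm _).trans_eq ?_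
  simp only [norm_smul, Real.norm_eq_abs, abs_of_nonneg (K.nonneg _ _), kernelIntegral,
    smul_eq_mul]

theorem kernelIntegral_nonneg {f : X → ℝ} (hf : ∀ᵐ v ∂μ, 0 ≤ f v) (v : X) :
    0 ≤ kernelIntegral μ k f v :=
  integral_nonneg_of_ae (hf.mono fun v' h => mul_nonneg (K.nonneg v v') h)

theorem norm_kernelIntegral_le_mul {f : X → H} (hf : Integrable f μ) (v : X) :
    ‖kernelIntegral μ k f v‖ ≤ β * ∫ v', ‖f v'‖ ∂μ := by
  rw [← integral_const_mul]
  refine norm_integral_le_of_norm_le (hf.norm.const_mul _) (Eventually.of_forall fun v' => ?_)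
  rw [norm_smul]
  gcongr
  exact K.norm_kernel_le v v'

theorem kernelIntegral_weight_le (v : X) : kernelIntegral μ k M v ≤ β := by
  have h := K.norm_kernelIntegral_le_mul K.integrable_weight v
  simp only [Real.norm_eq_abs, abs_of_pos (K.weight_pos _), K.integral_weight, mul_one] at h
  exact (le_abs_self _).trans h

theorem kernelIntegral_weight_nonneg (v : X) : 0 ≤ kernelIntegral μ k M v :=
  K.kernelIntegral_nonneg (Eventually.of_forall fun w => (K.weight_pos w).le) v

theorem le_relaxationFreq (v : X) : δ ≤ relaxationFreq μ k M δ v :=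
  le_add_of_nonneg_right (K.kernelIntegral_weight_nonneg v)

theorem relaxationFreq_pos (v : X) : 0 < relaxationFreq μ k M δ v :=
  K.rate_pos.trans_le (K.le_relaxationFreq v)

theorem abs_relaxationFreq_le (v : X) : |relaxationFreq μ k M δ v| ≤ δ + β := by
  rw [abs_of_pos (K.relaxationFreq_pos v)]
  exact add_le_add_right (K.kernelIntegral_weight_le v) δ

theorem kernelIntegral_weight_le_mul_relaxationFreq (v : X) :
    kernelIntegral μ k M v ≤ β / (δ + β) * relaxationFreq μ k M δ v := by
  have hδ := K.rate_pos
  have hβ := K.upper_nonneg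
  have hle := K.kernelIntegral_weight_le v
  rw [relaxationFreq, div_mul_eq_mul_div, le_div_iff₀ (by positivity)]
  nlinarith

section Borel

variable [BorelSpace X]

theorem integrable_kernel_smul {f : X → H} (hf : Integrable f μ) (v : X) :
    Integrable (fun v' => k v v' • f v') μ :=
  hf.bdd_smul β (K.continuous_kernel.comp (Continuous.prodMk_right v)).aestronglyMeasurable
    (Eventually.of_forall (K.norm_kernel_le v))

theorem kernelIntegral_sub {f g : X → H} (hf : Integrable f μ) (hg : Integrable g μ) (v : X) :
    kernelIntegral μ k (fun w => f w - g w) v =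
      kernelIntegral μ k f v - kernelIntegral μ k g v := by
  rw [kernelIntegral, kernelIntegral, kernelIntegral,
    ← integral_sub (K.integrable_kernel_smul hf v) (K.integrable_kernel_smul hg v)]
  simp only [smul_sub]

theorem kernelIntegral_comp_continuousLinearMap [CompleteSpace H] {G : Type*}
    [NormedAddCommGroup G] [NormedSpace ℝ G] [CompleteSpace G] (L : H →L[ℝ] G) {f : X → H}
    (hf : Integrable f μ) (v : X) :
    kernelIntegral μ k (fun w => L (f w)) v = L (kernelIntegral μ k f v) := by
  rw [kernelIntegral, kernelIntegral, ← L.integral_comp_comm (K.integrable_kernel_smul hf v)]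
  simp only [map_smul]

variable [SecondCountableTopology X]

theorem continuous_kernelIntegral {f : X → H} (hf : Integrable f μ) :
    Continuous (kernelIntegral μ k f) := by
  refine continuous_of_dominated (bound := fun v' => β * ‖f v'‖)
    (fun v => (K.integrable_kernel_smul hf v).aestronglyMeasurable)
    (fun v => Eventually.of_forall fun v' => ?_) (hf.norm.const_mul _)
    (Eventually.of_forall fun v' => ?_)
  · rw [norm_smul]
    gcongr
    exact K.norm_kernel_le v v'
  · exact (K.continuous_kernel.comp (Continuous.prodMk_left v')).smul continuous_const

theorem continuous_relaxationFreq : Continuous (relaxationFreq μ k M δ) :=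
  continuous_const.add (K.continuous_kernelIntegral K.integrable_weight)

theorem integrable_relaxationFreq_smul {f : X → H} (hf : Integrable f μ) :
    Integrable (fun v => relaxationFreq μ k M δ v • f v) μ :=
  hf.bdd_smul (δ + β) K.continuous_relaxationFreq.aestronglyMeasurable
    (Eventually.of_forall K.abs_relaxationFreq_le)

/-- The function `v ↦ ∫ k(v, v') f(v') dμ(v')`, as a bounded continuous function. -/
noncomputable def kernelBCF {f : X → H} (hf : Integrable f μ) : X →ᵇ H :=
  BoundedContinuousFunction.ofNormedAddCommGroup (kernelIntegral μ k f)
    (K.continuous_kernelIntegral hf) _ (K.norm_kernelIntegral_le_mul hf)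

theorem isDominated_weight_smul_kernelIntegral {f : X → H} (hf : Integrable f μ) :
    IsDominated M fun v => M v • kernelIntegral μ k f v :=
  K.isDominated_weight_smul (K.continuous_kernelIntegral hf) (K.norm_kernelIntegral_le_mul hf)

theorem integrable_weight_smul_kernelIntegral {f : X → H} (hf : Integrable f μ) :
    Integrable (fun v => M v • kernelIntegral μ k f v) μ :=
  (K.isDominated_weight_smul_kernelIntegral hf).integrable K.integrable_weight

theorem integrable_kernelIntegral_weight_smul {f : X → H} (hf : Integrable f μ) :
    Integrable (fun v => kernelIntegral μ k M v • f v) μ :=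
  hf.bdd_smul β (K.continuous_kernelIntegral K.integrable_weight).aestronglyMeasurable
    (Eventually.of_forall fun v => by
      rw [Real.norm_eq_abs, abs_of_nonneg (K.kernelIntegral_weight_nonneg v)]
      exact K.kernelIntegral_weight_le v)

theorem integral_weight_smul_kernelIntegral [SFinite μ] [CompleteSpace H] {f : X → H}
    (hf : Integrable f μ) :
    ∫ v, M v • kernelIntegral μ k f v ∂μ = ∫ v, kernelIntegral μ k M v • f v ∂μ := by
  have hprod : Integrable (fun p : X × X => k p.1 p.2 • M p.1 • f p.2) (μ.prod μ) :=
    (K.integrable_weight.smul_prod hf).bdd_smul β K.continuous_kernel.aestronglyMeasurable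
      (Eventually.of_forall fun p => K.norm_kernel_le p.1 p.2)
  calc ∫ v, M v • kernelIntegral μ k f v ∂μ
      = ∫ v, ∫ v', k v v' • M v • f v' ∂μ ∂μ := by
        simp only [kernelIntegral, ← integral_smul, smul_comm (M _)]
    _ = ∫ v', ∫ v, k v v' • M v • f v' ∂μ ∂μ := integral_integral_swap hprod
    _ = ∫ v', kernelIntegral μ k M v' • f v' ∂μ := by
        simp only [smul_smul, integral_smul_const, kernelIntegral, smul_eq_mul, K.symm]

theorem integral_relaxationFreq_smul {f : X → H} (hf : Integrable f μ) :
    ∫ v, relaxationFreq μ k M δ v • f v ∂μ =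
      δ • ∫ v, f v ∂μ + ∫ v, kernelIntegral μ k M v • f v ∂μ := by
  simp only [relaxationFreq, add_smul]
  rw [integral_add (hf.fun_smul δ) (K.integrable_kernelIntegral_weight_smul hf), integral_smul]

omit [NormedSpace ℝ H] in
theorem mul_integral_norm_le_integral_relaxationFreq {f : X → H} (hf : Integrable f μ) :
    δ * ∫ v, ‖f v‖ ∂μ ≤ ∫ v, relaxationFreq μ k M δ v * ‖f v‖ ∂μ := by
  rw [← integral_const_mul]
  exact integral_mono (hf.norm.const_mul δ) (K.integrable_relaxationFreq_smul hf.norm) fun v =>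
    mul_le_mul_of_nonneg_right (K.le_relaxationFreq v) (norm_nonneg _)

theorem norm_kernelIntegral_le_integral_relaxationFreq {f : X → H} (hf : Integrable f μ) (v : X) :
    ‖kernelIntegral μ k f v‖ ≤ β / δ * ∫ v, relaxationFreq μ k M δ v * ‖f v‖ ∂μ := by
  have hδ := K.rate_pos
  have hβ := K.upper_nonneg
  calc ‖kernelIntegral μ k f v‖ ≤ β * ∫ v', ‖f v'‖ ∂μ := K.norm_kernelIntegral_le_mul hf v
    _ = β / δ * (δ * ∫ v', ‖f v'‖ ∂μ) := by field_simp
    _ ≤ _ := by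
      gcongr
      exact K.mul_integral_norm_le_integral_relaxationFreq hf

theorem integral_weight_mul_norm_kernelIntegral_le [SFinite μ] {f : X → H}
    (hf : Integrable f μ) :
    ∫ v, M v * ‖kernelIntegral μ k f v‖ ∂μ ≤ ∫ v, kernelIntegral μ k M v * ‖f v‖ ∂μ := by
  have hMk := (K.isDominated_weight_smul (K.continuous_kernelIntegral hf).norm
    fun v => (norm_norm _).trans_le (K.norm_kernelIntegral_le_mul hf v)).integrable
    K.integrable_weight
  calc ∫ v, M v * ‖kernelIntegral μ k f v‖ ∂μ
      ≤ ∫ v, M v • kernelIntegral μ k (fun w => ‖f w‖) v ∂μ :=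
        integral_mono hMk (K.integrable_weight_smul_kernelIntegral hf.norm) fun v =>
          mul_le_mul_of_nonneg_left (K.norm_kernelIntegral_le f v) (K.weight_pos v).le
    _ = ∫ v, kernelIntegral μ k M v * ‖f v‖ ∂μ := K.integral_weight_smul_kernelIntegral hf.norm

theorem integral_weight_mul_norm_kernelIntegral_le_mul [SFinite μ] {f : X → H}
    (hf : Integrable f μ) :
    ∫ v, M v * ‖kernelIntegral μ k f v‖ ∂μ ≤
      β / (δ + β) * ∫ v, relaxationFreq μ k M δ v * ‖f v‖ ∂μ := by
  refine (K.integral_weight_mul_norm_kernelIntegral_le hf).trans ?_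
  rw [← integral_const_mul]
  refine integral_mono (K.integrable_kernelIntegral_weight_smul hf.norm)
    ((K.integrable_relaxationFreq_smul hf.norm).const_mul _) fun v => ?_
  simpa only [← mul_assoc] using mul_le_mul_of_nonneg_right
    (K.kernelIntegral_weight_le_mul_relaxationFreq v) (norm_nonneg (f v))

-- The gain `∫ M k‖f‖` is the loss `∫ ν‖f‖` minus `δ ∫ ‖f‖`, so a control of the loss by the gain
-- up to `κ` leaves `δ ∫ ‖f‖ ≤ κ`.
omit [NormedSpace ℝ H] in
theorem mul_integral_norm_le_of_integral_relaxationFreq_le [SFinite μ] {f : X → H} {κ : ℝ}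
    (hf : Integrable f μ)
    (hfκ : ∫ v, relaxationFreq μ k M δ v * ‖f v‖ ∂μ ≤
      ∫ v, M v * (κ + kernelIntegral μ k (fun w => ‖f w‖) v) ∂μ) :
    δ * ∫ v, ‖f v‖ ∂μ ≤ κ := by
  have hgain := K.integral_weight_smul_kernelIntegral hf.norm
  have hloss := K.integral_relaxationFreq_smul hf.norm
  have hsplit : ∫ v, M v * (κ + kernelIntegral μ k (fun w => ‖f w‖) v) ∂μ =
      κ + ∫ v, M v • kernelIntegral μ k (fun w => ‖f w‖) v ∂μ := by
    simp only [mul_add]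
    exact (integral_add (K.integrable_weight.mul_const κ)
      (K.integrable_weight_smul_kernelIntegral hf.norm)).trans
      (by rw [integral_mul_const, K.integral_weight, one_mul])
  simp only [smul_eq_mul] at hgain hloss hsplit
  linarith

end Borel

end ExcessKernel

end Kernel

theorem exists_fixedPoint_of_contracting_seminorm {Y : Type*} [NormedAddCommGroup Y]
    [CompleteSpace Y] {Φ : Y → Y} {N : Y → ℝ} {q L : ℝ} (hq₀ : 0 ≤ q) (hq₁ : q < 1) (hL : 0 ≤ L)
    (hN : ∀ y, N y ≤ ‖y‖) (hcontract : ∀ y y', N (Φ y - Φ y') ≤ q * N (y - y'))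
    (hsmooth : ∀ y y', ‖Φ y - Φ y'‖ ≤ L * N (y - y')) : ∃ y, Φ y = y := by
  have hiterate : ∀ n y y', N (Φ^[n] y - Φ^[n] y') ≤ q ^ n * ‖y - y'‖ := fun n y y' => by
    induction n with
    | zero => simpa using hN (y - y')
    | succ n ih =>
      rw [Function.iterate_succ_apply', Function.iterate_succ_apply', pow_succ', mul_assoc]
      exact (hcontract _ _).trans (mul_le_mul_of_nonneg_left ih hq₀)
  have hlim : Tendsto (fun n => L * q ^ n) atTop (𝓝 0) := by
    simpa using (tendsto_pow_atTop_nhds_zero_of_lt_one hq₀ hq₁).const_mul L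
  obtain ⟨n, hn⟩ := (hlim.eventually (gt_mem_nhds one_pos)).exists
  have hcontracting : ContractingWith (L * q ^ n).toNNReal Φ^[n + 1] := by
    refine ⟨by simpa using hn, LipschitzWith.of_dist_le_mul fun y y' => ?_⟩
    rw [Real.coe_toNNReal _ (by positivity), dist_eq_norm, dist_eq_norm,
      Function.iterate_succ_apply', Function.iterate_succ_apply', mul_assoc]
    exact (hsmooth _ _).trans (mul_le_mul_of_nonneg_left (hiterate n y y') hL)
  exact ⟨_, hcontracting.isFixedPt_fixedPoint_iterate⟩

section Stationary

open scoped BoundedContinuousFunction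

variable {V : Type*} [NormedAddCommGroup V] [NormedSpace ℝ V] [MeasurableSpace V] [BorelSpace V]
  [FiniteDimensional ℝ V] {μ : Measure V} [μ.IsAddHaarMeasure]
  {H : Type*} [NormedAddCommGroup H] [NormedSpace ℝ H]
  {M : V → ℝ} {E : V} {c A : ℝ}

theorem DampedTransport.integral_freq_mul_norm_le {ν : V → ℝ} (D : DampedTransport ν M E c A)
    (hM : Integrable M μ) {B : ℝ} (hν : ∀ v, |ν v| ≤ B) {f h : V → H} {g : V → ℝ}
    (hf : SolvesTransport ν E f h) (hfM : IsDominated M f) (hg : IsDominated M g)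
    (hhg : ∀ v, ‖h v‖ ≤ g v) : ∫ v, ν v * ‖f v‖ ∂μ ≤ ∫ v, g v ∂μ := by
  have hT := D.isDominated_transportInv hg
  have hνT := (hT.smul_of_bounded D.continuous_freq hν).integrable hM
  have hνf := (hfM.norm.smul_of_bounded D.continuous_freq hν).integrable hM
  calc ∫ v, ν v * ‖f v‖ ∂μ ≤ ∫ v, ν v • transportInv ν E g v ∂μ := by
        refine integral_mono hνf hνT fun v => mul_le_mul_of_nonneg_left
          (D.norm_le_transportInv hf hfM hg hhg v) ?_
        linarith [D.le_freq v, D.rate_pos]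
    _ = ∫ v, g v ∂μ := (D.solvesTransport_transportInv hg).integral_freq_smul_eq
        (hT.integrable hM) hνT (hg.integrable hM)

namespace ExcessKernel

variable {k : V → V → ℝ} {δ β : ℝ} (K : ExcessKernel μ k M δ β)
include K

omit [μ.IsAddHaarMeasure] in
theorem isDominated_weight_smul_add_kernelIntegral {s : V → H} {B : ℝ} (hs : Continuous s)
    (hsB : ∀ v, ‖s v‖ ≤ B) {f : V → H} (hf : Integrable f μ) :
    IsDominated M fun v => M v • (s v + kernelIntegral μ k f v) :=
  K.isDominated_weight_smul (hs.add (K.continuous_kernelIntegral hf)) fun v =>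
    (norm_add_le _ _).trans (add_le_add (hsB v) (K.norm_kernelIntegral_le_mul hf v))

theorem smul_integral_eq_of_solvesTransport [CompleteSpace H] {f s : V → H} {B : ℝ}
    (hf : Integrable f μ) (hs : Continuous s) (hsB : ∀ v, ‖s v‖ ≤ B)
    (hsol : SolvesTransport (relaxationFreq μ k M δ) E f
      fun v => M v • (s v + kernelIntegral μ k f v)) :
    δ • ∫ v, f v ∂μ = ∫ v, M v • s v ∂μ := by
  have hbalance := hsol.integral_freq_smul_eq hf (K.integrable_relaxationFreq_smul hf)
    ((K.isDominated_weight_smul_add_kernelIntegral hs hsB hf).integrable K.integrable_weight)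
  simp only [smul_add] at hbalance
  rw [integral_add ((K.isDominated_weight_smul hs hsB).integrable K.integrable_weight)
    (K.integrable_weight_smul_kernelIntegral hf), K.integral_weight_smul_kernelIntegral hf,
    K.integral_relaxationFreq_smul hf] at hbalance
  exact add_right_cancel hbalance

variable (D : DampedTransport (relaxationFreq μ k M δ) M E c A)
include D

/-- The operator `b ↦ k (E · ∇ + ν)⁻¹ (M b)` on bounded continuous functions, whose fixed points up
to a source `s` are the functions `s + k f` for the solutions of `E · ∇f + ν f = M (s + k f)`. -/
noncomputable def scatteredTransport (b : V →ᵇ H) : V →ᵇ H :=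
  K.kernelBCF <| (D.isDominated_transportInv <|
    K.isDominated_weight_smul b.continuous b.norm_coe_le_norm).integrable K.integrable_weight

omit [μ.IsAddHaarMeasure] in
theorem scatteredTransport_sub (b b' : V →ᵇ H) :
    K.scatteredTransport D b - K.scatteredTransport D b' = K.scatteredTransport D (b - b') := by
  have hdom (b : V →ᵇ H) := K.isDominated_weight_smul b.continuous b.norm_coe_le_norm
  have hint (b : V →ᵇ H) := (D.isDominated_transportInv (hdom b)).integrable K.integrable_weight
  ext v
  refine (K.kernelIntegral_sub (hint b) (hint b') v).symm.trans ?_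
  simp only [← D.transportInv_sub (hdom b) (hdom b'), ← smul_sub]
  rfl

theorem integral_relaxationFreq_mul_norm_transportInv_le [CompleteSpace H] (b : V →ᵇ H) :
    ∫ v, relaxationFreq μ k M δ v *
      ‖transportInv (relaxationFreq μ k M δ) E (fun w => M w • b w) v‖ ∂μ ≤
      ∫ v, M v * ‖b v‖ ∂μ := by
  have hdom := K.isDominated_weight_smul b.continuous b.norm_coe_le_norm
  have hnorm (v : V) : ‖M v • b v‖ = M v * ‖b v‖ := by
    rw [norm_smul, Real.norm_eq_abs, abs_of_pos (K.weight_pos v)]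
  exact D.integral_freq_mul_norm_le K.integrable_weight K.abs_relaxationFreq_le
    (D.solvesTransport_transportInv hdom) (D.isDominated_transportInv hdom)
    (by simpa only [hnorm] using hdom.norm) fun v => (hnorm v).le

theorem integral_weight_mul_norm_scatteredTransport_le [CompleteSpace H] (b : V →ᵇ H) :
    ∫ v, M v * ‖K.scatteredTransport D b v‖ ∂μ ≤ β / (δ + β) * ∫ v, M v * ‖b v‖ ∂μ := by
  have hδ := K.rate_pos
  have hβ := K.upper_nonneg
  have hdom := K.isDominated_weight_smul b.continuous b.norm_coe_le_norm
  refine (K.integral_weight_mul_norm_kernelIntegral_le_mul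
    ((D.isDominated_transportInv hdom).integrable K.integrable_weight)).trans ?_
  exact mul_le_mul_of_nonneg_left (K.integral_relaxationFreq_mul_norm_transportInv_le D b)
    (by positivity)

theorem norm_scatteredTransport_le [CompleteSpace H] (b : V →ᵇ H) :
    ‖K.scatteredTransport D b‖ ≤ β / δ * ∫ v, M v * ‖b v‖ ∂μ := by
  have hδ := K.rate_pos
  have hβ := K.upper_nonneg
  have hdom := K.isDominated_weight_smul b.continuous b.norm_coe_le_norm
  have hnonneg : 0 ≤ ∫ v, M v * ‖b v‖ ∂μ := integral_nonneg fun v =>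
    mul_nonneg (K.weight_pos v).le (norm_nonneg _)
  refine (BoundedContinuousFunction.norm_le (by positivity)).2 fun v => ?_
  refine (K.norm_kernelIntegral_le_integral_relaxationFreq
    ((D.isDominated_transportInv hdom).integrable K.integrable_weight) v).trans ?_
  exact mul_le_mul_of_nonneg_left (K.integral_relaxationFreq_mul_norm_transportInv_le D b)
    (by positivity)

theorem exists_add_scatteredTransport_eq [CompleteSpace H] (s : V →ᵇ H) :
    ∃ b, s + K.scatteredTransport D b = b := by
  have hδ := K.rate_pos
  have hβ := K.upper_nonneg
  have hmean (b : V →ᵇ H) : ∫ v, M v * ‖b v‖ ∂μ ≤ ‖b‖ := by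
    have hdom : IsDominated M fun v => M v * ‖b v‖ :=
      K.isDominated_weight_smul b.continuous.norm fun v =>
        (norm_norm _).trans_le (b.norm_coe_le_norm v)
    calc ∫ v, M v * ‖b v‖ ∂μ ≤ ∫ v, M v * ‖b‖ ∂μ :=
          integral_mono (hdom.integrable K.integrable_weight) (K.integrable_weight.mul_const _)
            fun v => mul_le_mul_of_nonneg_left (b.norm_coe_le_norm v) (K.weight_pos v).le
      _ = ‖b‖ := by rw [integral_mul_const, K.integral_weight, one_mul]
  refine exists_fixedPoint_of_contracting_seminorm (N := fun b : V →ᵇ H => ∫ v, M v * ‖b v‖ ∂μ)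
    (div_nonneg hβ (by positivity)) ((div_lt_one (by positivity)).2 (lt_add_of_pos_left β hδ))
    (div_nonneg hβ hδ.le) hmean (fun b b' => ?_) fun b b' => ?_
  · rw [add_sub_add_left_eq_sub, K.scatteredTransport_sub D]
    exact K.integral_weight_mul_norm_scatteredTransport_le D (b - b')
  · rw [add_sub_add_left_eq_sub, K.scatteredTransport_sub D]
    exact K.norm_scatteredTransport_le D (b - b')

theorem exists_solvesTransport [CompleteSpace H] (s : V →ᵇ H) :
    ∃ f : V → H, IsDominated M f ∧ SolvesTransport (relaxationFreq μ k M δ) E f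
      fun v => M v • (s v + kernelIntegral μ k f v) := by
  obtain ⟨b, hb⟩ := K.exists_add_scatteredTransport_eq D s
  have hdom : IsDominated M fun w => M w • b w :=
    K.isDominated_weight_smul b.continuous b.norm_coe_le_norm
  refine ⟨_, D.isDominated_transportInv hdom, ?_⟩
  convert D.solvesTransport_transportInv hdom using 3 with v
  exact congrArg (fun b : V →ᵇ H => b v) hb

variable {f h : V → H} {κ : ℝ} (hf : SolvesTransport (relaxationFreq μ k M δ) E f h)
  (hfM : IsDominated M f) (hh : ∀ v, ‖h v‖ ≤ M v * (κ + kernelIntegral μ k (fun w => ‖f w‖) v))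
include hf hfM hh

theorem mul_integral_norm_le : δ * ∫ v, ‖f v‖ ∂μ ≤ κ :=
  K.mul_integral_norm_le_of_integral_relaxationFreq_le (hfM.integrable K.integrable_weight) <|
    D.integral_freq_mul_norm_le K.integrable_weight K.abs_relaxationFreq_le hf hfM
      (K.isDominated_weight_smul_add_kernelIntegral continuous_const (fun _ => le_rfl)
        (hfM.integrable K.integrable_weight).norm) hh

theorem norm_le_mul_weight (v : V) : ‖f v‖ ≤ (κ + β / δ * κ) * A / c * M v := by
  have hδ := K.rate_pos
  have hβ := K.upper_nonneg
  have hfi := hfM.integrable K.integrable_weight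
  have hmass : β * ∫ w, ‖f w‖ ∂μ ≤ β / δ * κ := by
    calc β * ∫ w, ‖f w‖ ∂μ = β / δ * (δ * ∫ w, ‖f w‖ ∂μ) := by field_simp
      _ ≤ β / δ * κ := by
        gcongr
        exact K.mul_integral_norm_le D hf hfM hh
  have hsource (w : V) : ‖M w * (κ + kernelIntegral μ k (fun w => ‖f w‖) w)‖ ≤
      (κ + β / δ * κ) * M w := by
    rw [Real.norm_eq_abs, abs_of_nonneg ((norm_nonneg _).trans (hh w)), mul_comm]
    refine mul_le_mul_of_nonneg_right (add_le_add_right ?_ κ) (K.weight_pos w).le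
    refine (le_abs_self _).trans ((K.norm_kernelIntegral_le_mul hfi.norm w).trans ?_)
    simpa only [norm_norm] using hmass
  calc ‖f v‖ ≤ transportInv _ E
        (fun w => M w * (κ + kernelIntegral μ k (fun w => ‖f w‖) w)) v :=
        D.norm_le_transportInv hf hfM
          (K.isDominated_weight_smul_add_kernelIntegral continuous_const (fun _ => le_rfl)
            hfi.norm) hh v
    _ ≤ _ := (le_abs_self _).trans (D.norm_transportInv_le_mul hsource v)

end ExcessKernel

theorem ae_nonneg_of_integral_norm_le {X : Type*} [MeasurableSpace X] {ρ : Measure X} {f : X → ℝ}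
    (hf : Integrable f ρ) (hle : ∫ v, ‖f v‖ ∂ρ ≤ ∫ v, f v ∂ρ) : ∀ᵐ v ∂ρ, 0 ≤ f v := by
  have hgap : ∫ v, (‖f v‖ - f v) ∂ρ = 0 := by
    refine le_antisymm ?_ (integral_nonneg fun v => sub_nonneg.2 (Real.le_norm_self _))
    rw [integral_sub hf.norm hf]
    exact sub_nonpos.2 hle
  have hgap' := (integral_eq_zero_iff_of_nonneg (fun v => sub_nonneg.2 (Real.le_norm_self (f v)))
    (hf.norm.sub hf)).1 hgap
  filter_upwards [hgap'] with v hv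
  rw [← sub_eq_zero.1 hv]
  exact norm_nonneg _

theorem ExcessKernel.exists_pos_solvesTransport {k : V → V → ℝ} {δ β : ℝ}
    (K : ExcessKernel μ k M δ β) (D : DampedTransport (relaxationFreq μ k M δ) M E c A) :
    ∃ F : V → ℝ, IsDominated M F ∧ (∀ v, 0 < F v) ∧ ∫ v, F v ∂μ = 1 ∧
      SolvesTransport (relaxationFreq μ k M δ) E F
        fun v => M v * (δ + kernelIntegral μ k F v) := by
  have hδ := K.rate_pos
  obtain ⟨F, hF, hsol⟩ :=
    K.exists_solvesTransport D (BoundedContinuousFunction.const V δ)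
  have hFi := hF.integrable K.integrable_weight
  have hsource := K.isDominated_weight_smul_add_kernelIntegral (s := fun _ => δ)
    continuous_const (fun _ => le_rfl) hFi
  have hmass : ∫ v, F v ∂μ = 1 := by
    have h := K.smul_integral_eq_of_solvesTransport hFi continuous_const (fun _ => le_rfl) hsol
    simp only [smul_eq_mul, integral_mul_const, K.integral_weight, one_mul] at h
    exact mul_left_cancel₀ hδ.ne' (h.trans (mul_one δ).symm)
  have hnorm : δ * ∫ v, ‖F v‖ ∂μ ≤ δ := by
    refine K.mul_integral_norm_le D hsol hF fun v => ?_
    rw [norm_smul, Real.norm_eq_abs, abs_of_pos (K.weight_pos v)]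
    refine mul_le_mul_of_nonneg_left ((norm_add_le _ _).trans (add_le_add ?_ ?_))
      (K.weight_pos v).le
    · exact (abs_of_pos hδ).le
    · exact K.norm_kernelIntegral_le F v
  have hnonneg : ∀ᵐ v ∂μ, 0 ≤ F v := ae_nonneg_of_integral_norm_le hFi
    (hmass ▸ le_of_mul_le_mul_left (hnorm.trans_eq (mul_one δ).symm) hδ)
  refine ⟨F, hF, fun v => ?_, hmass, hsol⟩
  rw [D.eq_transportInv hsol hF hsource]
  exact D.transportInv_pos hsource (fun w => mul_pos (K.weight_pos w)
    (add_pos_of_pos_of_nonneg hδ (K.kernelIntegral_nonneg hnonneg w))) v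

end Stationary

section WeakTransport

theorem integrable_mul_comp_sub {V : Type*} [NormedAddCommGroup V] [MeasurableSpace V]
    [BorelSpace V] {μ : Measure V} {u ψ : V → ℝ} (hu : Integrable u μ) (hψ : Continuous ψ)
    (hψc : HasCompactSupport ψ) (w : V) : Integrable (fun v => u v * ψ (v - w)) μ := by
  obtain ⟨C, hC⟩ := hψc.exists_bound_of_continuous hψ
  exact hu.mul_bdd (c := C) (hψ.comp (continuous_sub_right w)).aestronglyMeasurable
    (Eventually.of_forall fun v => hC _)

variable {V : Type*} [NormedAddCommGroup V] [NormedSpace ℝ V] [MeasurableSpace V]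
  {μ : Measure V} {E : V} {u u' k k' : V → ℝ}

/-- The equation `E · ∇u = k` in the sense of distributions. -/
def IsWeakLineDeriv (μ : Measure V) (E : V) (u k : V → ℝ) : Prop :=
  ∀ φ : V → ℝ, ContDiff ℝ ∞ φ → HasCompactSupport φ →
    -∫ v, u v * fderiv ℝ φ v E ∂μ = ∫ v, k v * φ v ∂μ

theorem IsWeakLineDeriv.integral_mul_fderiv_comp_sub (h : IsWeakLineDeriv μ E u k) {φ : V → ℝ}
    (hφ : ContDiff ℝ ∞ φ) (hφc : HasCompactSupport φ) (w : V) :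
    -∫ v, u v * fderiv ℝ φ (v - w) E ∂μ = ∫ v, k v * φ (v - w) ∂μ := by
  simpa only [fderiv_comp_sub] using h (fun v => φ (v - w))
    (hφ.comp (contDiff_id.sub contDiff_const)) (hφc.comp_homeomorph (Homeomorph.subRight w))

variable [BorelSpace V]

theorem IsWeakLineDeriv.sub (h : IsWeakLineDeriv μ E u k)
    (h' : IsWeakLineDeriv μ E u' k') (hu : Integrable u μ) (hu' : Integrable u' μ)
    (hk : Integrable k μ) (hk' : Integrable k' μ) :
    IsWeakLineDeriv μ E (fun v => u v - u' v) fun v => k v - k' v := fun φ hφ hφc => by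
  have hφ' : Continuous fun v => fderiv ℝ φ v E :=
    (hφ.continuous_fderiv (by simp)).clm_apply continuous_const
  have hmul' {f : V → ℝ} (hf : Integrable f μ) : Integrable (fun v => f v * fderiv ℝ φ v E) μ := by
    simpa only [sub_zero] using integrable_mul_comp_sub hf hφ' (hφc.fderiv_apply (𝕜 := ℝ) E) 0
  have hmul {f : V → ℝ} (hf : Integrable f μ) : Integrable (fun v => f v * φ v) μ := by
    simpa only [sub_zero] using integrable_mul_comp_sub hf hφ.continuous hφc 0
  simp only [sub_mul]
  rw [integral_sub (hmul' hu) (hmul' hu'), integral_sub (hmul hk) (hmul hk'), ← h φ hφ hφc,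
    ← h' φ hφ hφc]
  ring

theorem IsWeakLineDeriv.hasDerivAt_integral_mul_comp_sub (h : IsWeakLineDeriv μ E u k)
    (hu : Integrable u μ) {φ : V → ℝ} (hφ : ContDiff ℝ ∞ φ) (hφc : HasCompactSupport φ)
    (s : ℝ) :
    HasDerivAt (fun s : ℝ => ∫ v, u v * φ (v - s • E) ∂μ) (∫ v, k v * φ (v - s • E) ∂μ) s := by
  have hφ' : Continuous (fderiv ℝ φ) := hφ.continuous_fderiv (by simp)
  obtain ⟨C, hC⟩ := (hφc.fderiv (𝕜 := ℝ)).exists_bound_of_continuous hφ'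
  have hint (s : ℝ) := integrable_mul_comp_sub hu hφ.continuous hφc (s • E)
  have hmeas : Continuous fun v => fderiv ℝ φ (v - s • E) E := by fun_prop
  have hbound (v : V) (s : ℝ) : ‖-(u v * fderiv ℝ φ (v - s • E) E)‖ ≤ ‖u v‖ * (C * ‖E‖) := by
    rw [norm_neg, norm_mul]
    gcongr
    exact ContinuousLinearMap.le_of_opNorm_le _ (hC _) E
  have hderiv (v : V) (s : ℝ) : HasDerivAt (fun s : ℝ => u v * φ (v - s • E))
      (-(u v * fderiv ℝ φ (v - s • E) E)) s := by
    have hline : HasDerivAt (fun s : ℝ => v - s • E) (-((1 : ℝ) • E)) s :=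
      ((hasDerivAt_id s).smul_const E).const_sub v
    refine (((hφ.differentiable (by simp) (v - s • E)).hasFDerivAt.comp_hasDerivAt s
      hline).const_mul (u v)).congr_deriv ?_
    simp
  have hresult := (hasDerivAt_integral_of_dominated_loc_of_deriv_le (μ := μ) univ_mem
    (Eventually.of_forall fun s => (hint s).aestronglyMeasurable) (hint s)
    (hu.aestronglyMeasurable.mul hmeas.aestronglyMeasurable).neg
    (Eventually.of_forall fun v s _ => hbound v s) (hu.norm.mul_const _)
    (Eventually.of_forall fun v s _ => hderiv v s)).2
  rwa [integral_neg, h.integral_mul_fderiv_comp_sub hφ hφc] at hresult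

variable [μ.IsAddHaarMeasure]

theorem IsWeakLineDeriv.integral_mul_translate_sub (h : IsWeakLineDeriv μ E u k)
    (hu : Integrable u μ) (hk : Integrable k μ) {φ : V → ℝ} (hφ : ContDiff ℝ ∞ φ)
    (hφc : HasCompactSupport φ) (t : ℝ) :
    ∫ v, u (v + t • E) * φ v ∂μ - ∫ v, u v * φ v ∂μ =
      ∫ s in (0 : ℝ)..t, ∫ v, k (v + s • E) * φ v ∂μ := by
  have hshift (f : V → ℝ) (s : ℝ) : ∫ v, f v * φ (v - s • E) ∂μ = ∫ v, f (v + s • E) * φ v ∂μ := by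
    rw [← integral_add_right_eq_self _ (s • E)]
    simp only [add_sub_cancel_right]
  obtain ⟨C, hC⟩ := hφc.exists_bound_of_continuous hφ.continuous
  have hcont : Continuous fun s : ℝ => ∫ v, k v * φ (v - s • E) ∂μ := by
    refine continuous_of_dominated (bound := fun v => ‖k v‖ * C)
      (fun s => (integrable_mul_comp_sub hk hφ.continuous hφc _).aestronglyMeasurable)
      (fun s => Eventually.of_forall fun v => ?_) (hk.norm.mul_const _)
      (Eventually.of_forall fun v => ?_)
    · rw [norm_mul]
      gcongr
      exact hC _
    · have := hφ.continuous
      fun_prop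
  have hFTC := intervalIntegral.integral_eq_sub_of_hasDerivAt
    (fun s _ => h.hasDerivAt_integral_mul_comp_sub hu hφ hφc s) (hcont.intervalIntegrable 0 t)
  simpa only [hshift, zero_smul, add_zero, sub_zero] using hFTC.symm

variable [FiniteDimensional ℝ V]

theorem tendsto_integral_norm_translate_sub {H : Type*} [NormedAddCommGroup H] {k : V → H}
    (hk : Integrable k μ) (E : V) :
    Tendsto (fun τ : ℝ => ∫ v, ‖k (v + τ • E) - k v‖ ∂μ) (𝓝 0) (𝓝 0) := by
  have hkLp : MemLp k 1 μ := memLp_one_iff_integrable.2 hk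
  let T : C(ℝ, C(V, V)) := (ContinuousMap.mk (fun p : ℝ × V => p.2 + p.1 • E) (by fun_prop)).curry
  have hT : ∀ τ, MeasurePreserving (T τ) μ μ := fun τ => measurePreserving_add_right μ (τ • E)
  have hcont : Continuous fun τ =>
      ‖Lp.compMeasurePreserving (T τ) (hT τ) hkLp.toLp - hkLp.toLp‖ :=
    ((continuous_const.compMeasurePreservingLp T.continuous hT ENNReal.one_ne_top).sub
      continuous_const).norm
  have hnorm : ∀ τ, ‖Lp.compMeasurePreserving (T τ) (hT τ) hkLp.toLp - hkLp.toLp‖ =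
      ∫ v, ‖k (v + τ • E) - k v‖ ∂μ := fun τ => by
    rw [L1.norm_eq_integral_norm]
    refine integral_congr_ae ?_
    filter_upwards [Lp.coeFn_sub (Lp.compMeasurePreserving (T τ) (hT τ) hkLp.toLp) hkLp.toLp,
      Lp.coeFn_compMeasurePreserving hkLp.toLp (hT τ), hkLp.coeFn_toLp,
      (hT τ).quasiMeasurePreserving.ae hkLp.coeFn_toLp] with v hsub hcomp hv hTv
    rw [hsub, Pi.sub_apply, hcomp, hv, Function.comp, hTv]
    rfl
  simpa only [hnorm, zero_smul, add_zero, sub_self, norm_zero, integral_zero] using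
    hcont.tendsto 0

theorem integrable_translate_prod {H : Type*} [NormedAddCommGroup H] {k : V → H}
    (hk : Integrable k μ) (E : V) (S : Set ℝ)
    [IsFiniteMeasure (volume.restrict S)] :
    Integrable (fun p : ℝ × V => k (p.2 + p.1 • E)) ((volume.restrict S).prod μ) := by
  have hmp : MeasurePreserving (fun p : ℝ × V => (p.1, p.2 + p.1 • E))
      ((volume.restrict S).prod μ) ((volume.restrict S).prod μ) :=
    (MeasurePreserving.id _).skew_product (g := fun (τ : ℝ) (v : V) => v + τ • E)
      (show Continuous fun p : ℝ × V => p.2 + p.1 • E by fun_prop).measurable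
      (Eventually.of_forall fun τ => (measurePreserving_add_right μ (τ • E)).map_eq)
  exact hmp.integrable_comp_of_integrable (hk.comp_snd _)

namespace IsWeakLineDeriv

theorem of_hasLineDerivAt (hu : Integrable u μ) (hk : Integrable k μ)
    (h : ∀ v, HasLineDerivAt ℝ u (k v) v E) : IsWeakLineDeriv μ E u k := fun φ hφ hφc => by
  have hφ' : Continuous fun v => fderiv ℝ φ v E :=
    (hφ.continuous_fderiv (by simp)).clm_apply continuous_const
  have huφ' := integrable_mul_comp_sub hu hφ' (hφc.fderiv_apply (𝕜 := ℝ) E) 0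
  have huφ := integrable_mul_comp_sub hu hφ.continuous hφc 0
  have hkφ := integrable_mul_comp_sub hk hφ.continuous hφc 0
  simp only [sub_zero] at huφ' huφ hkφ
  rw [neg_eq_iff_eq_neg]
  exact integral_bilinear_hasLineDerivAt_right_eq_neg_left_of_integrable
    (B := ContinuousLinearMap.mul ℝ ℝ) hkφ huφ' huφ (fun v _ => h v)
    fun v _ => ((hφ.differentiable (by simp)) v).hasFDerivAt.hasLineDerivAt E

theorem translate_sub_eq_integral (h : IsWeakLineDeriv μ E u k) (hu : Integrable u μ)
    (hk : Integrable k μ) {t : ℝ} (ht : 0 ≤ t) :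
    ∀ᵐ v ∂μ, u (v + t • E) - u v = ∫ τ in Set.Ioc 0 t, k (v + τ • E) := by
  have hkt := integrable_translate_prod hk E (Set.Ioc 0 t)
  have hut : Integrable (fun v => u (v + t • E)) μ := hu.comp_add_right _
  have hkint : Integrable (fun v => ∫ τ in Set.Ioc 0 t, k (v + τ • E)) μ := hkt.integral_prod_right
  suffices hzero : ∀ᵐ v ∂μ, u (v + t • E) - u v - ∫ τ in Set.Ioc 0 t, k (v + τ • E) = 0 by
    filter_upwards [hzero] with v hv using sub_eq_zero.1 hv
  refine ae_eq_zero_of_integral_contDiff_smul_eq_zero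
    ((hut.sub hu).sub hkint).locallyIntegrable fun φ hφ hφc => ?_
  have hmul {f : V → ℝ} (hf : Integrable f μ) : Integrable (fun v => f v * φ v) μ := by
    simpa only [sub_zero] using integrable_mul_comp_sub hf hφ.continuous hφc 0
  obtain ⟨C, hC⟩ := hφc.exists_bound_of_continuous hφ.continuous
  have hswap : ∫ s in Set.Ioc 0 t, ∫ v, k (v + s • E) * φ v ∂μ =
      ∫ v, (∫ s in Set.Ioc 0 t, k (v + s • E)) * φ v ∂μ := by
    simp only [← integral_mul_const]
    exact integral_integral_swap (hkt.mul_bdd (c := C) (g := fun p : ℝ × V => φ p.2)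
      (hφ.continuous.comp continuous_snd).aestronglyMeasurable
      (Eventually.of_forall fun p => hC _))
  have hbalance := h.integral_mul_translate_sub hu hk hφ hφc t
  rw [intervalIntegral.integral_of_le ht, hswap] at hbalance
  simp only [smul_eq_mul, mul_comm (φ _), sub_mul]
  have hdiff : Integrable (fun v => u (v + t • E) * φ v - u v * φ v) μ := (hmul hut).sub (hmul hu)
  rw [integral_sub hdiff (hmul hkint), integral_sub (hmul hut) (hmul hu), hbalance, sub_self]

theorem integral_norm_translate_sub_le (h : IsWeakLineDeriv μ E u k) (hu : Integrable u μ)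
    (hk : Integrable k μ) {ε : ℝ} (hε : 0 < ε) :
    ∀ᶠ t in 𝓝[>] (0 : ℝ), ∫ v, |u (v + t • E) - u v - t * k v| ∂μ ≤ t * ε := by
  obtain ⟨η, hη, hball⟩ := Metric.eventually_nhds_iff.1
    ((tendsto_integral_norm_translate_sub hk E).eventually (gt_mem_nhds hε))
  filter_upwards [Ioo_mem_nhdsGT hη] with t ht
  have hkt := integrable_translate_prod hk E (Set.Ioc 0 t)
  have hosc : Integrable (fun p : ℝ × V => ‖k (p.2 + p.1 • E) - k p.2‖)
      ((volume.restrict (Set.Ioc 0 t)).prod μ) := (hkt.sub (hk.comp_snd _)).norm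
  calc ∫ v, |u (v + t • E) - u v - t * k v| ∂μ
      ≤ ∫ v, (∫ τ in Set.Ioc 0 t, ‖k (v + τ • E) - k v‖) ∂μ := by
        refine integral_mono_ae (((hu.comp_add_right _).sub hu).sub (hk.const_mul t)).abs
          hosc.integral_prod_right ?_
        filter_upwards [h.translate_sub_eq_integral hu hk ht.1.le, hkt.prod_left_ae] with v hv hkv
        have hconst : t * k v = ∫ _ in Set.Ioc 0 t, k v := by simp [ht.1.le]
        rw [hv, hconst, ← integral_sub hkv (by simp)]
        exact norm_integral_le_integral_norm fun τ => k (v + τ • E) - k v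
    _ = ∫ τ in Set.Ioc 0 t, ∫ v, ‖k (v + τ • E) - k v‖ ∂μ := (integral_integral_swap hosc).symm
    _ ≤ ∫ _ in Set.Ioc 0 t, ε := by
        refine setIntegral_mono_on hosc.integral_prod_left (by simp) measurableSet_Ioc
          fun τ hτ => (hball ?_).le
        rw [Real.dist_eq, sub_zero, abs_of_pos hτ.1]
        exact hτ.2.trans_lt ht.2
    _ = t * ε := by simp [ht.1.le]

-- For small `t`, `u (v + tE)` is `(1 - t ν v) * u v + t * h v` up to an error of size `o(t)` in
-- `L¹`, and `1 - t ν ≥ 0`.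
theorem integral_freq_mul_abs_le {ν h : V → ℝ} {B : ℝ}
    (hw : IsWeakLineDeriv μ E u fun v => h v - ν v * u v) (hu : Integrable u μ)
    (hh : Integrable h μ) (hν : Continuous ν) (hν₀ : ∀ v, 0 ≤ ν v) (hνB : ∀ v, ν v ≤ B) :
    ∫ v, ν v * |u v| ∂μ ≤ ∫ v, |h v| ∂μ := by
  have hνmul {f : V → ℝ} (hf : Integrable f μ) : Integrable (fun v => ν v * f v) μ :=
    hf.bdd_mul (c := B) hν.aestronglyMeasurable (Eventually.of_forall fun v => by
      rw [Real.norm_eq_abs, abs_of_nonneg (hν₀ v)]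
      exact hνB v)
  have hk : Integrable (fun v => h v - ν v * u v) μ := hh.sub (hνmul hu)
  refine le_of_forall_pos_le_add fun ε hε => ?_
  have hsmall : ∀ᶠ t in 𝓝[>] (0 : ℝ), t * B < 1 :=
    (tendsto_nhdsWithin_of_tendsto_nhds
      ((continuous_mul_const B).tendsto' 0 0 (zero_mul B))).eventually_lt_const one_pos
  obtain ⟨t, hrem, htB, ht⟩ := ((hw.integral_norm_translate_sub_le hu hk hε).and
    (hsmall.and self_mem_nhdsWithin)).exists
  set r : V → ℝ := fun v => |u (v + t • E) - u v - t * (h v - ν v * u v)|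
  have hr : Integrable r μ := (((hu.comp_add_right _).sub hu).sub (hk.const_mul t)).abs
  have hdamped : Integrable (fun v => |u v| - t * (ν v * |u v|)) μ :=
    hu.abs.sub ((hνmul hu.abs).const_mul t)
  have hsource : Integrable (fun v => |u v| - t * (ν v * |u v|) + t * |h v|) μ :=
    hdamped.add (hh.abs.const_mul t)
  have hpointwise (v : V) : |u (v + t • E)| ≤ |u v| - t * (ν v * |u v|) + t * |h v| + r v := by
    have hfactor : 0 ≤ 1 - t * ν v := by nlinarith [hνB v, ht.le]
    calc |u (v + t • E)| = |(1 - t * ν v) * u v + t * h v +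
          (u (v + t • E) - u v - t * (h v - ν v * u v))| := by ring_nf
      _ ≤ (1 - t * ν v) * |u v| + t * |h v| + r v := by
          refine (abs_add_le _ _).trans (add_le_add_left ((abs_add_le _ _).trans_eq ?_) _)
          rw [abs_mul, abs_mul, abs_of_nonneg hfactor, abs_of_pos ht]
      _ = _ := by ring
  have hint := integral_mono (hu.comp_add_right (t • E)).abs (hsource.add hr) hpointwise
  simp only [Pi.add_apply] at hint
  rw [integral_add hsource hr,
    integral_add hdamped (hh.abs.const_mul t), integral_sub hu.abs ((hνmul hu.abs).const_mul t),
    integral_const_mul, integral_const_mul,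
    integral_add_right_eq_self (fun v => |u v|) (t • E)] at hint
  refine le_of_mul_le_mul_left ?_ ht
  linarith

end IsWeakLineDeriv

end WeakTransport

section InvWeight

variable {d : ℕ} {M : EuclideanSpace ℝ (Fin d) → ℝ} {H : Type*} [NormedAddCommGroup H]
  {f : EuclideanSpace ℝ (Fin d) → H}

theorem integrable_of_memLp_invWeight (hM : Measurable M) (hpos : ∀ v, 0 < M v)
    (hMi : Integrable M) (hf : MemLp f 2 (invWeight M)) : Integrable f := by
  have hdensity : Measurable fun v => ENNReal.ofReal (M v)⁻¹ := hM.inv.ennreal_ofReal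
  have hac : (volume : Measure (EuclideanSpace ℝ (Fin d))) ≪ invWeight M :=
    withDensity_absolutelyContinuous' hdensity.aemeasurable
      (Eventually.of_forall fun v => by simpa using hpos v)
  have hsq : Integrable fun v => ‖f v‖ ^ 2 * (M v)⁻¹ := by
    have hpow := hf.integrable_norm_pow (p := 2) two_ne_zero
    rw [invWeight, integrable_withDensity_iff hdensity
      (Eventually.of_forall fun v => ENNReal.ofReal_lt_top)] at hpow
    simpa only [ENNReal.toReal_ofReal (inv_nonneg.2 (hpos _).le)] using hpow
  refine (hsq.add hMi).mono' (hf.1.mono_ac hac) (Eventually.of_forall fun v => ?_)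
  rw [Pi.add_apply, ← div_eq_mul_inv, div_add' _ _ _ (hpos v).ne', le_div_iff₀ (hpos v)]
  nlinarith [sq_nonneg (‖f v‖ - M v), norm_nonneg (f v), hpos v]

theorem eLpNorm_self_invWeight (hM : Measurable M) (hpos : ∀ v, 0 < M v) (hmass : ∫ v, M v = 1) :
    eLpNorm M 2 (invWeight M) = 1 := by
  have hdensity : Measurable fun v => ENNReal.ofReal (M v)⁻¹ := hM.inv.ennreal_ofReal
  have hintegrand : ((fun v => ENNReal.ofReal (M v)⁻¹) * fun v => ‖M v‖ₑ ^ (2 : ℝ)) =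
      fun v => ENNReal.ofReal (M v) := funext fun v => by
    have hv := hpos v
    simp only [Pi.mul_apply, ENNReal.rpow_ofNat, Real.enorm_eq_ofReal hv.le]
    rw [← ENNReal.ofReal_pow hv.le, ← ENNReal.ofReal_mul (by positivity)]
    congr 1
    field_simp
  rw [eLpNorm_eq_lintegral_rpow_enorm_toReal two_ne_zero ENNReal.ofNat_ne_top, invWeight,
    ENNReal.toReal_ofNat, lintegral_withDensity_eq_lintegral_mul _ hdensity (by fun_prop),
    hintegrand, ← ofReal_integral_eq_lintegral_ofReal (integrable_of_integral_eq_one hmass)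
      (Eventually.of_forall fun v => (hpos v).le), hmass, ENNReal.ofReal_one, ENNReal.one_rpow]

theorem eLpNorm_invWeight_le (hM : Measurable M) (hpos : ∀ v, 0 < M v) (hmass : ∫ v, M v = 1)
    {B : ℝ} (hf : ∀ v, ‖f v‖ ≤ B * M v) : eLpNorm f 2 (invWeight M) ≤ ENNReal.ofReal B := by
  have hB : 0 ≤ B := nonneg_of_mul_nonneg_left ((norm_nonneg _).trans (hf 0)) (hpos 0)
  calc eLpNorm f 2 (invWeight M) ≤ eLpNorm (B • M) 2 (invWeight M) := eLpNorm_mono_real hf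
    _ = ENNReal.ofReal B := by
        rw [eLpNorm_const_smul, eLpNorm_self_invWeight hM hpos hmass, mul_one,
          Real.enorm_eq_ofReal hB]

theorem IsDominated.memLp_invWeight (hM : Measurable M) (hpos : ∀ v, 0 < M v)
    (hmass : ∫ v, M v = 1) (hf : IsDominated M f) : MemLp f 2 (invWeight M) := by
  obtain ⟨B, hB⟩ := hf.bound
  exact ⟨hf.continuous.aestronglyMeasurable,
    (eLpNorm_invWeight_le hM hpos hmass hB).trans_lt ENNReal.ofReal_lt_top⟩

end InvWeight

theorem div_one_add_le_add_mul_inv {C ε r x : ℝ} (hε : 0 < ε) (hx : |x| ≤ r) :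
    C / (1 + r) ≤ ε + C ^ 2 / ε * (1 + x ^ 2)⁻¹ := by
  have hr : 0 ≤ r := (abs_nonneg x).trans hx
  have hsq : ((1 + r)⁻¹) ^ 2 ≤ (1 + x ^ 2)⁻¹ := by
    rw [inv_pow]
    refine inv_anti₀ (by positivity) ?_
    nlinarith [sq_le_sq' (abs_le.1 hx).1 (abs_le.1 hx).2]
  calc C / (1 + r) ≤ ε + C ^ 2 / ε * ((1 + r)⁻¹) ^ 2 := by
        rw [div_eq_mul_inv, ← sub_nonneg]
        set s := (1 + r)⁻¹
        have hsquare : ε + C ^ 2 / ε * s ^ 2 - C * s =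
            ((ε - C * s / 2) ^ 2 + 3 / 4 * (C * s) ^ 2) / ε := by
          field_simp
          ring
        rw [hsquare]
        positivity
    _ ≤ _ := by gcongr

theorem sub_le_add_mul_pi_of_hasDerivAt_le {φ φ' : ℝ → ℝ} {a ℓ ε B : ℝ} (hB : 0 ≤ B)
    (hφ : ∀ t, HasDerivAt φ (φ' t) t)
    (hle : ∀ t, φ' t ≤ (ε + B * (1 + (a + t * ℓ) ^ 2)⁻¹) * ℓ) :
    φ 1 - φ 0 ≤ ε * ℓ + B * Real.pi := by
  let ψ : ℝ → ℝ := fun t => φ t - ε * (t * ℓ) - B * Real.arctan (a + t * ℓ)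
  have hψ : ∀ t, HasDerivAt ψ (φ' t - ε * ℓ - B * ((1 + (a + t * ℓ) ^ 2)⁻¹ * ℓ)) t := fun t => by
    have hspeed : HasDerivAt (fun t : ℝ => t * ℓ) ℓ t := by
      simpa using (hasDerivAt_id t).mul_const ℓ
    refine (((hφ t).sub (hspeed.const_mul ε)).sub
      ((hspeed.const_add a).arctan.const_mul B)).congr_deriv ?_
    rw [one_div]
  have hanti : Antitone ψ := antitone_of_deriv_nonpos (fun t => (hψ t).differentiableAt) fun t => by
    rw [(hψ t).deriv]
    linarith [hle t]
  have hψ01 := hanti zero_le_one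
  simp only [ψ, one_mul, zero_mul, mul_zero] at hψ01
  nlinarith [Real.arctan_lt_pi_div_two (a + ℓ), Real.neg_pi_div_two_lt_arctan (a + 0)]

-- Along a line with unit speed, `|D log M| ≤ C / (1 + |v|)` is at most `ε` up to the derivative of
-- a multiple of the bounded function `arctan`.
theorem exists_translate_le_of_norm_fderiv_le {V : Type*} [NormedAddCommGroup V]
    [InnerProductSpace ℝ V] {M : V → ℝ} {C ε : ℝ} (hM : Differentiable ℝ M) (hpos : ∀ v, 0 < M v)
    (hC : ∀ v, ‖fderiv ℝ M v‖ ≤ C * (M v / (1 + ‖v‖))) (hε : 0 < ε) :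
    ∃ A, ∀ v w, M (v + w) ≤ A * Real.exp (ε * ‖w‖) * M v := by
  refine ⟨Real.exp (C ^ 2 / ε * Real.pi), fun v w => ?_⟩
  have hnorm : ∀ t : ℝ, |inner ℝ v w / ‖w‖ + t * ‖w‖| ≤ ‖v + t • w‖ := fun t => by
    have hproj : inner ℝ v w / ‖w‖ + t * ‖w‖ = inner ℝ (v + t • w) w / ‖w‖ := by
      rw [inner_add_left, real_inner_smul_left, real_inner_self_eq_norm_mul_norm, add_div,
        mul_div_assoc t, mul_self_div_self]
    rw [hproj, abs_div, abs_norm]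
    exact div_le_of_le_mul₀ (norm_nonneg w) (norm_nonneg _) (abs_real_inner_le_norm _ _)
  have hderiv : ∀ t, HasDerivAt (fun t : ℝ => Real.log (M (v + t • w)))
      (fderiv ℝ M (v + t • w) w / M (v + t • w)) t := fun t => by
    have hline : HasDerivAt (fun t : ℝ => v + t • w) w t := by
      simpa using ((hasDerivAt_id t).smul_const w).const_add v
    exact ((hM _).hasFDerivAt.comp_hasDerivAt t hline).log (hpos _).ne'
  have hlog := sub_le_add_mul_pi_of_hasDerivAt_le (by positivity) hderiv fun t =>
    calc fderiv ℝ M (v + t • w) w / M (v + t • w) ≤ C / (1 + ‖v + t • w‖) * ‖w‖ := by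
          rw [div_le_iff₀ (hpos _)]
          calc fderiv ℝ M (v + t • w) w ≤ ‖fderiv ℝ M (v + t • w)‖ * ‖w‖ :=
                (le_abs_self _).trans ((fderiv ℝ M (v + t • w)).le_opNorm w)
            _ ≤ C * (M (v + t • w) / (1 + ‖v + t • w‖)) * ‖w‖ := by gcongr; exact hC _
            _ = _ := by ring
      _ ≤ _ := mul_le_mul_of_nonneg_right
        (div_one_add_le_add_mul_inv hε (hnorm t)) (norm_nonneg w)
  simp only [one_smul, zero_smul, add_zero] at hlog
  rw [← Real.exp_log (hpos (v + w))]
  calc _ ≤ Real.exp (C ^ 2 / ε * Real.pi + ε * ‖w‖ + Real.log (M v)) :=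
        Real.exp_le_exp.2 (by linarith)
    _ = _ := by rw [Real.exp_add, Real.exp_add, Real.exp_log (hpos v)]

section Boltzmann

variable {d : ℕ} {M : EuclideanSpace ℝ (Fin d) → ℝ}
  {σ : EuclideanSpace ℝ (Fin d) → EuclideanSpace ℝ (Fin d) → ℝ}

/-- A positive, twice differentiable probability density with `|DM| ≤ C M` and `|D²M| ≤ C M`,
growing slower than any exponential under translations. -/
structure SubexponentialEquilibrium (M : EuclideanSpace ℝ (Fin d) → ℝ) : Prop where
  pos : ∀ v, 0 < M v
  integral_eq_one : ∫ v, M v = 1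
  differentiable : Differentiable ℝ M
  differentiable_fderiv : Differentiable ℝ (fderiv ℝ M)
  fderiv_bound : ∃ C : ℝ, ∀ v, ‖fderiv ℝ M v‖ ≤ C * M v
  fderiv_fderiv_bound : ∃ C : ℝ, ∀ v, ‖fderiv ℝ (fderiv ℝ M) v‖ ≤ C * M v
  translate_le : ∀ ε > 0, ∃ A : ℝ, ∀ v w, M (v + w) ≤ A * Real.exp (ε * ‖w‖) * M v

/-- A symmetric cross section, bounded between two positive constants and differentiable in each
variable with bounded derivative. -/
structure LipschitzCrossSection
    (σ : EuclideanSpace ℝ (Fin d) → EuclideanSpace ℝ (Fin d) → ℝ) : Prop where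
  symm : ∀ v v', σ v v' = σ v' v
  bounds : ∃ ν₁ ν₂ : ℝ, 0 < ν₁ ∧ ∀ v v', ν₁ ≤ σ v v' ∧ σ v v' ≤ ν₂
  differentiable : ∀ v', Differentiable ℝ (σ v')
  fderiv_bound : ∃ C : ℝ, ∀ v' v, ‖fderiv ℝ (σ v') v‖ ≤ C

theorem HeavyTailEquilibrium.subexponentialEquilibrium {α : ℝ} (hM : HeavyTailEquilibrium α M) :
    SubexponentialEquilibrium M := by
  obtain ⟨C, hC⟩ := hM.fderiv_bound
  refine ⟨hM.pos, hM.integral_eq_one, hM.differentiable, hM.differentiable_fderiv,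
    ⟨|C|, fun v => (hC v).trans ?_⟩, hM.fderiv_fderiv_bound,
    fun ε hε => exists_translate_le_of_norm_fderiv_le hM.differentiable hM.pos hC hε⟩
  have hMv := (hM.pos v).le
  exact mul_le_mul (le_abs_self C) (div_le_self hMv (by linarith [norm_nonneg v]))
    (by positivity) (abs_nonneg C)

theorem AdmissibleCrossSection.lipschitzCrossSection (hσ : AdmissibleCrossSection M σ) :
    LipschitzCrossSection σ := by
  obtain ⟨C, hC⟩ := hσ.fderiv_bound
  have hC₀ : 0 ≤ C := by simpa using (norm_nonneg _).trans (hC 0 0)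
  exact ⟨hσ.symm, hσ.bounds, hσ.differentiable, C, fun v' v =>
    (hC v' v).trans (div_le_self hC₀ (by linarith [norm_nonneg v]))⟩

/-- The part `σ - δ` of the cross section `σ` that is left after splitting off the constant `δ`. -/
def excess (σ : EuclideanSpace ℝ (Fin d) → EuclideanSpace ℝ (Fin d) → ℝ) (δ : ℝ)
    (v v' : EuclideanSpace ℝ (Fin d)) : ℝ :=
  σ v v' - δ

theorem LipschitzCrossSection.continuous_uncurry (hσ : LipschitzCrossSection σ) :
    Continuous (Function.uncurry σ) := by
  obtain ⟨C, hC⟩ := hσ.fderiv_bound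
  have hC₀ : 0 ≤ C := (norm_nonneg _).trans (hC 0 0)
  have hlip : ∀ v', LipschitzWith C.toNNReal (σ v') := fun v' =>
    lipschitzWith_of_nnnorm_fderiv_le (hσ.differentiable v') fun v =>
      (Real.le_toNNReal_iff_coe_le hC₀).2 (hC v' v)
  exact (LipschitzWith.uncurry (fun v => by simpa only [hσ.symm _ v] using hlip v) hlip).continuous

theorem LipschitzCrossSection.exists_excessKernel (hσ : LipschitzCrossSection σ)
    (hM : SubexponentialEquilibrium M) :
    ∃ δ β, ExcessKernel volume (excess σ δ) M δ β := by
  obtain ⟨ν₁, ν₂, hν₁, hbounds⟩ := hσ.bounds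
  exact ⟨ν₁, ν₂ - ν₁, hσ.continuous_uncurry.sub continuous_const,
    fun v v' => congrArg (· - ν₁) (hσ.symm v v'), fun v v' => sub_nonneg.2 (hbounds v v').1,
    fun v v' => sub_le_sub_right (hbounds v v').2 ν₁, hν₁, hM.differentiable.continuous, hM.pos,
    hM.integral_eq_one⟩

namespace ExcessKernel

variable {δ β : ℝ} (K : ExcessKernel volume (excess σ δ) M δ β)
include K

theorem exists_dampedTransport (hM : SubexponentialEquilibrium M) (R : ℝ) :
    ∃ A, ∀ E : EuclideanSpace ℝ (Fin d), ‖E‖ ≤ R →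
      DampedTransport (relaxationFreq volume (excess σ δ) M δ) M E (δ / 2) A := by
  have hδ := K.rate_pos
  obtain ⟨A, hA⟩ := hM.translate_le (δ / 2 / (|R| + 1)) (by positivity)
  have hA₀ : 0 ≤ A := by
    refine nonneg_of_mul_nonneg_left ((hM.pos (0 + 0)).le.trans ?_) (hM.pos 0)
    simpa only [norm_zero, mul_zero, Real.exp_zero, mul_one] using hA 0 0
  refine ⟨A, fun E hE => ⟨K.continuous_relaxationFreq, K.continuous_weight, by positivity,
    fun v => by linarith [K.le_relaxationFreq v], K.weight_pos, fun v x hx => ?_⟩⟩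
  have hMv := (K.weight_pos v).le
  refine (hA v (x • E)).trans ?_
  gcongr
  calc δ / 2 / (|R| + 1) * ‖x • E‖ ≤ δ / 2 / (|R| + 1) * (-x * (|R| + 1)) := by
        rw [norm_smul, Real.norm_eq_abs, abs_of_nonpos hx]
        gcongr
        · linarith
        · linarith [le_abs_self R]
    _ = -(δ / 2 * x) := by field_simp

variable {H : Type*} [NormedAddCommGroup H] [NormedSpace ℝ H]

theorem boltzmannQ_eq [CompleteSpace H] {f : EuclideanSpace ℝ (Fin d) → H} (hf : Integrable f)
    (v : EuclideanSpace ℝ (Fin d)) :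
    boltzmannQ σ M f v = M v • (δ • (∫ w, f w) + kernelIntegral volume (excess σ δ) f v) -
      relaxationFreq volume (excess σ δ) M δ v • f v := by
  have hgain : Integrable fun w => M v • (δ • f w + excess σ δ v w • f w) :=
    ((hf.fun_smul δ).add (K.integrable_kernel_smul hf v)).fun_smul (M v)
  have hloss : Integrable fun w => (δ • M w + excess σ δ v w • M w) • f v :=
    ((K.integrable_weight.fun_smul δ).add
      (K.integrable_kernel_smul K.integrable_weight v)).smul_const (f v)
  calc boltzmannQ σ M f v
      = ∫ w, (M v • (δ • f w + excess σ δ v w • f w) -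
          (δ • M w + excess σ δ v w • M w) • f v) := integral_congr_ae <|
        Eventually.of_forall fun w => by
          have hsymm : σ w v = excess σ δ v w + δ := by rw [K.symm v w, excess, sub_add_cancel]
          have hσ : σ v w = excess σ δ v w + δ := by rw [excess, sub_add_cancel]
          simp only [hsymm, hσ, smul_eq_mul]
          module
    _ = _ := by
      rw [integral_sub hgain hloss, integral_smul, integral_smul_const,
        integral_add (hf.fun_smul δ) (K.integrable_kernel_smul hf v),
        integral_add (K.integrable_weight.fun_smul δ)
          (K.integrable_kernel_smul K.integrable_weight v), integral_smul, integral_smul,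
        K.integral_weight, smul_eq_mul, mul_one, kernelIntegral, relaxationFreq, kernelIntegral]

theorem integrable_boltzmannQ [CompleteSpace H] {f : EuclideanSpace ℝ (Fin d) → H}
    (hf : Integrable f) : Integrable (boltzmannQ σ M f) := by
  have hgain : Integrable fun v => M v • δ • ∫ w, f w := K.integrable_weight.smul_const _
  refine ((hgain.add (K.integrable_weight_smul_kernelIntegral hf)).sub
    (K.integrable_relaxationFreq_smul hf)).congr (Eventually.of_forall fun v => ?_)
  simp only [Pi.sub_apply, Pi.add_apply, K.boltzmannQ_eq hf, smul_add]

theorem boltzmannQ_sub [CompleteSpace H] {f g : EuclideanSpace ℝ (Fin d) → H}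
    (hf : Integrable f) (hg : Integrable g) (hfg : ∫ v, f v = ∫ v, g v)
    (v : EuclideanSpace ℝ (Fin d)) :
    boltzmannQ σ M f v - boltzmannQ σ M g v =
      M v • kernelIntegral volume (excess σ δ) (fun w => f w - g w) v -
        relaxationFreq volume (excess σ δ) M δ v • (f v - g v) := by
  rw [K.boltzmannQ_eq hf, K.boltzmannQ_eq hg, hfg, K.kernelIntegral_sub hf hg]
  module

theorem ae_eq_zero_of_integral_relaxationFreq_le {u : EuclideanSpace ℝ (Fin d) → H}
    (hu : Integrable u) (h : ∫ v, relaxationFreq volume (excess σ δ) M δ v * ‖u v‖ ≤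
      ∫ v, ‖M v • kernelIntegral volume (excess σ δ) u v‖) : u =ᵐ[volume] 0 := by
  have hle : δ * ∫ v, ‖u v‖ ≤ 0 := by
    refine K.mul_integral_norm_le_of_integral_relaxationFreq_le hu (h.trans ?_)
    simp only [zero_add]
    refine integral_mono (K.integrable_weight_smul_kernelIntegral hu).norm
      (K.integrable_weight_smul_kernelIntegral hu.norm) fun v => ?_
    simp only [norm_smul, Real.norm_eq_abs, abs_of_pos (K.weight_pos v)]
    exact mul_le_mul_of_nonneg_left (K.norm_kernelIntegral_le u v) (K.weight_pos v).le
  have hzero : ∫ v, ‖u v‖ = 0 :=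
    (nonpos_of_mul_nonpos_right hle K.rate_pos).antisymm (integral_nonneg fun v => norm_nonneg _)
  filter_upwards [(integral_eq_zero_iff_of_nonneg (fun v => norm_nonneg _) hu.norm).1 hzero]
    with v hv using norm_eq_zero.1 hv

theorem ae_eq_of_boltzmannQ_ae_eq [CompleteSpace H] {f g : EuclideanSpace ℝ (Fin d) → H}
    (hf : Integrable f) (hg : Integrable g) (hfg : ∫ v, f v = ∫ v, g v)
    (hQ : boltzmannQ σ M f =ᵐ[volume] boltzmannQ σ M g) : f =ᵐ[volume] g := by
  have hbalance : ∀ᵐ v, M v • kernelIntegral volume (excess σ δ) (fun w => f w - g w) v =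
      relaxationFreq volume (excess σ δ) M δ v • (f v - g v) := hQ.mono fun v hv => by
    rw [← sub_eq_zero, ← K.boltzmannQ_sub hf hg hfg, hv, sub_self]
  have hu : Integrable fun v => f v - g v := hf.sub hg
  have hzero := K.ae_eq_zero_of_integral_relaxationFreq_le hu <| le_of_eq <|
    integral_congr_ae <| hbalance.mono fun v hv => by
      simp only [hv, norm_smul, Real.norm_eq_abs, abs_of_pos (K.relaxationFreq_pos v)]
  exact hzero.mono fun v hv => sub_eq_zero.1 hv

theorem ae_eq_of_isModifiedEquilibrium {E : EuclideanSpace ℝ (Fin d)}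
    {f g : EuclideanSpace ℝ (Fin d) → ℝ} (hf : IsModifiedEquilibrium σ M E f)
    (hg : IsModifiedEquilibrium σ M E g) : f =ᵐ[volume] g := by
  have hMm := K.continuous_weight.measurable
  have hfi := integrable_of_memLp_invWeight hMm K.weight_pos K.integrable_weight hf.memLp
  have hgi := integrable_of_memLp_invWeight hMm K.weight_pos K.integrable_weight hg.memLp
  have hu : Integrable fun v => f v - g v := hfi.sub hgi
  have hweak : IsWeakLineDeriv volume E (fun v => f v - g v) fun v =>
      M v • kernelIntegral volume (excess σ δ) (fun w => f w - g w) v -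
        relaxationFreq volume (excess σ δ) M δ v * (f v - g v) := by
    convert IsWeakLineDeriv.sub hf.weak_eq hg.weak_eq hfi hgi (K.integrable_boltzmannQ hfi)
      (K.integrable_boltzmannQ hgi) using 2 with v
    exact (K.boltzmannQ_sub hfi hgi (hf.mass.trans hg.mass.symm) v).symm
  have hzero := K.ae_eq_zero_of_integral_relaxationFreq_le hu <|
    hweak.integral_freq_mul_abs_le hu (K.integrable_weight_smul_kernelIntegral hu)
      K.continuous_relaxationFreq (fun v => (K.relaxationFreq_pos v).le)
      fun v => (le_abs_self _).trans (K.abs_relaxationFreq_le v)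
  exact hzero.mono fun v hv => sub_eq_zero.1 hv

end ExcessKernel

end Boltzmann

section DominatedDiff

variable {V : Type*} [NormedAddCommGroup V] [NormedSpace ℝ V]
  {H : Type*} [NormedAddCommGroup H] [NormedSpace ℝ H]

/-- `f` is differentiable, and both `f` and its derivative are bounded by a multiple of the weight
`m`. -/
structure IsDominatedDiff (m : V → ℝ) (f : V → H) : Prop where
  differentiable : Differentiable ℝ f
  bound : ∃ B, ∀ v, ‖f v‖ ≤ B * m v
  fderiv_bound : ∃ B, ∀ v, ‖fderiv ℝ f v‖ ≤ B * m v

namespace IsDominatedDiff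

variable {m m₁ m₂ a : V → ℝ} {f g : V → H}

theorem sub (hf : IsDominatedDiff m f) (hg : IsDominatedDiff m g) :
    IsDominatedDiff m fun v => f v - g v := by
  obtain ⟨B, hB⟩ := hf.bound
  obtain ⟨C, hC⟩ := hg.bound
  obtain ⟨B', hB'⟩ := hf.fderiv_bound
  obtain ⟨C', hC'⟩ := hg.fderiv_bound
  refine ⟨hf.differentiable.sub hg.differentiable, ⟨B + C, fun v => ?_⟩, B' + C', fun v => ?_⟩
  · rw [add_mul]
    exact (norm_sub_le _ _).trans (add_le_add (hB v) (hC v))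
  · rw [add_mul, fderiv_fun_sub (hf.differentiable v) (hg.differentiable v)]
    exact (norm_sub_le _ _).trans (add_le_add (hB' v) (hC' v))

theorem smul (ha : IsDominatedDiff m₁ a) (hf : IsDominatedDiff m₂ f) :
    IsDominatedDiff (fun v => m₁ v * m₂ v) fun v => a v • f v := by
  obtain ⟨B, hB⟩ := ha.bound
  obtain ⟨C, hC⟩ := hf.bound
  obtain ⟨B', hB'⟩ := ha.fderiv_bound
  obtain ⟨C', hC'⟩ := hf.fderiv_bound
  have hprod : ∀ {x y b c : ℝ} (v : V), 0 ≤ x → 0 ≤ y → x ≤ b * m₁ v → y ≤ c * m₂ v →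
      x * y ≤ b * c * (m₁ v * m₂ v) := fun v hx hy hxb hyc =>
    (mul_le_mul hxb hyc hy (hx.trans hxb)).trans_eq (by ring)
  refine ⟨ha.differentiable.smul hf.differentiable, ⟨B * C, fun v => ?_⟩, B * C' + B' * C,
    fun v => ?_⟩
  · rw [norm_smul]
    exact hprod v (norm_nonneg _) (norm_nonneg _) (hB v) (hC v)
  · rw [fderiv_fun_smul (ha.differentiable v) (hf.differentiable v), add_mul]
    refine (norm_add_le _ _).trans (add_le_add ?_ ?_)
    · rw [norm_smul]
      exact hprod v (norm_nonneg _) (norm_nonneg _) (hB v) (hC' v)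
    · rw [ContinuousLinearMap.norm_smulRight_apply]
      exact hprod v (norm_nonneg _) (norm_nonneg _) (hB' v) (hC v)

theorem inv {δ : ℝ} (hδ : 0 < δ) (ha : IsDominatedDiff (fun _ => 1) a) (hle : ∀ v, δ ≤ a v) :
    IsDominatedDiff (fun _ => 1) fun v => (a v)⁻¹ := by
  have hpos : ∀ v, 0 < a v := fun v => hδ.trans_le (hle v)
  have hinv : ∀ v, (a v)⁻¹ ≤ δ⁻¹ := fun v => inv_anti₀ hδ (hle v)
  obtain ⟨B, hB⟩ := ha.fderiv_bound
  refine ⟨ha.differentiable.inv fun v => (hpos v).ne', ⟨δ⁻¹, fun v => ?_⟩, (δ⁻¹) ^ 2 * B,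
    fun v => ?_⟩
  · rw [Real.norm_eq_abs, abs_of_pos (inv_pos.2 (hpos v)), mul_one]
    exact hinv v
  · have hderiv :=
      (hasDerivAt_inv (hpos v).ne').comp_hasFDerivAt v (ha.differentiable v).hasFDerivAt
    rw [show (fun v => (a v)⁻¹) = Inv.inv ∘ a from rfl, hderiv.fderiv, norm_smul, norm_neg,
      Real.norm_eq_abs, abs_of_pos (inv_pos.2 (pow_pos (hpos v) 2)), ← inv_pow, mul_assoc]
    have hinv₀ := (inv_pos.2 (hpos v)).le
    gcongr
    · exact hle v
    · exact hB v

end IsDominatedDiff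

variable [FiniteDimensional ℝ V] [MeasurableSpace V] [BorelSpace V] {μ : Measure V}
  {k : V → V → ℝ} {M : V → ℝ} {δ β C : ℝ}

theorem ExcessKernel.hasFDerivAt_kernelIntegral (K : ExcessKernel μ k M δ β)
    (hk : ∀ v', Differentiable ℝ (k v')) (hC : ∀ v' v, ‖fderiv ℝ (k v') v‖ ≤ C) {f : V → H}
    (hf : Integrable f μ) (v : V) :
    HasFDerivAt (kernelIntegral μ k f) (∫ v', (fderiv ℝ (k v') v).smulRight (f v') ∂μ) v := by
  have hmeas : Measurable fun v' => fderiv ℝ (k v') v :=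
    (measurable_fderiv_with_param ℝ K.continuous_kernel).comp
      (measurable_id.prodMk measurable_const)
  refine hasFDerivAt_integral_of_dominated_of_fderiv_le (s := Set.univ)
    (F := fun w v' => k w v' • f v') (F' := fun w v' => (fderiv ℝ (k v') w).smulRight (f v'))
    (bound := fun v' => C * ‖f v'‖) univ_mem
    (Eventually.of_forall fun w => (K.integrable_kernel_smul hf w).aestronglyMeasurable)
    (K.integrable_kernel_smul hf v) ?_ (Eventually.of_forall fun v' w _ => ?_)
    (hf.norm.const_mul C) (Eventually.of_forall fun v' w _ => ?_)
  · exact (ContinuousLinearMap.smulRightL ℝ V H).aestronglyMeasurable_comp₂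
      hmeas.aestronglyMeasurable hf.aestronglyMeasurable
  · rw [ContinuousLinearMap.norm_smulRight_apply]
    gcongr
    exact hC v' w
  · simpa only [K.symm v'] using (hk v' w).hasFDerivAt.smul_const (f v')

theorem ExcessKernel.isDominatedDiff_kernelIntegral (K : ExcessKernel μ k M δ β)
    (hk : ∀ v', Differentiable ℝ (k v')) (hC : ∀ v' v, ‖fderiv ℝ (k v') v‖ ≤ C) {f : V → H}
    (hf : Integrable f μ) : IsDominatedDiff (fun _ => 1) (kernelIntegral μ k f) := by
  have hderiv := K.hasFDerivAt_kernelIntegral hk hC hf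
  refine ⟨fun v => (hderiv v).differentiableAt, ⟨β * ∫ v', ‖f v'‖ ∂μ, fun v => ?_⟩,
    C * ∫ v', ‖f v'‖ ∂μ, fun v => ?_⟩
  · rw [mul_one]
    exact K.norm_kernelIntegral_le_mul hf v
  · rw [(hderiv v).fderiv, mul_one, ← integral_const_mul]
    refine norm_integral_le_of_norm_le (hf.norm.const_mul C) (Eventually.of_forall fun v' => ?_)
    rw [ContinuousLinearMap.norm_smulRight_apply]
    gcongr
    exact hC v' v

theorem ExcessKernel.isDominatedDiff_relaxationFreq (K : ExcessKernel μ k M δ β)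
    (hk : ∀ v', Differentiable ℝ (k v')) (hC : ∀ v' v, ‖fderiv ℝ (k v') v‖ ≤ C) :
    IsDominatedDiff (fun _ => 1) (relaxationFreq μ k M δ) := by
  have hdiff := K.isDominatedDiff_kernelIntegral hk hC K.integrable_weight
  refine ⟨hdiff.differentiable.const_add δ, ⟨δ + β, fun v => ?_⟩, ?_⟩
  · rw [mul_one]
    exact K.abs_relaxationFreq_le v
  · unfold relaxationFreq
    simpa only [fderiv_const_add] using hdiff.fderiv_bound

end DominatedDiff

section LinearResponse

variable {d : ℕ} {M : EuclideanSpace ℝ (Fin d) → ℝ}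
  {σ : EuclideanSpace ℝ (Fin d) → EuclideanSpace ℝ (Fin d) → ℝ}

namespace SubexponentialEquilibrium

variable (hM : SubexponentialEquilibrium M)
include hM

theorem isDominatedDiff : IsDominatedDiff M M :=
  ⟨hM.differentiable, ⟨1, fun v => by rw [Real.norm_eq_abs, abs_of_pos (hM.pos v), one_mul]⟩,
    hM.fderiv_bound⟩

theorem isDominatedDiff_gradient : IsDominatedDiff M (gradient M) := by
  obtain ⟨C, hC⟩ := hM.fderiv_bound
  obtain ⟨C', hC'⟩ := hM.fderiv_fderiv_bound
  let L : (EuclideanSpace ℝ (Fin d) →L[ℝ] ℝ) ≃ₗᵢ[ℝ] EuclideanSpace ℝ (Fin d) :=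
    (InnerProductSpace.toDual ℝ (EuclideanSpace ℝ (Fin d))).symm
  refine ⟨L.differentiable.comp hM.differentiable_fderiv, ⟨C, fun v => ?_⟩, C', fun v => ?_⟩
  · rw [gradient, LinearIsometryEquiv.norm_map]
    exact hC v
  · rw [show gradient M = L ∘ fderiv ℝ M from rfl, L.comp_fderiv]
    exact (L.toLinearIsometry.norm_toContinuousLinearMap_comp).trans_le (hC' v)

theorem integral_gradient : ∫ v, gradient M v = 0 := by
  have hMi : Integrable M := .of_integral_ne_zero (by simp [hM.integral_eq_one])
  have hgrad : IsDominated M (gradient M) :=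
    ⟨hM.isDominatedDiff_gradient.differentiable.continuous, hM.isDominatedDiff_gradient.bound⟩
  refine ext_inner_left ℝ fun E => ?_
  have hEi := (hgrad.integrable hMi).const_inner (𝕜 := ℝ) E
  rw [inner_zero_right, ← integral_inner (hgrad.integrable hMi)]
  exact integral_lineDeriv_eq_zero (E := E) (fun v => by
    rw [inner_gradient_right, conj_trivial]
    exact (hM.differentiable v).hasFDerivAt.hasLineDerivAt E) hMi hEi

end SubexponentialEquilibrium

/-- `F` is dominated by `M`, has unit mass, and solves `E · ∇F = Q(F)` pointwise. -/
structure IsClassicalEquilibrium (σ : EuclideanSpace ℝ (Fin d) → EuclideanSpace ℝ (Fin d) → ℝ)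
    (M : EuclideanSpace ℝ (Fin d) → ℝ) (E : EuclideanSpace ℝ (Fin d))
    (F : EuclideanSpace ℝ (Fin d) → ℝ) : Prop where
  isDominated : IsDominated M F
  hasLineDerivAt : ∀ v, HasLineDerivAt ℝ F (boltzmannQ σ M F v) v E
  mass : ∫ v, F v = 1

/-- The response `lam` of the equilibrium to an infinitesimal field: the solution of
`Q(lam) = ∇M` of mean zero, dominated by `M`. -/
structure IsLinearResponse (σ : EuclideanSpace ℝ (Fin d) → EuclideanSpace ℝ (Fin d) → ℝ)
    (M : EuclideanSpace ℝ (Fin d) → ℝ) (lam : EuclideanSpace ℝ (Fin d) → EuclideanSpace ℝ (Fin d)) :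
    Prop where
  isDominated : IsDominated M lam
  boltzmannQ_eq : ∀ v, boltzmannQ σ M lam v = gradient M v
  integral_eq_zero : ∫ v, lam v = 0

namespace ExcessKernel

variable {δ β : ℝ} (K : ExcessKernel volume (excess σ δ) M δ β)
include K

theorem exists_pos_isClassicalEquilibrium (hM : SubexponentialEquilibrium M)
    (E : EuclideanSpace ℝ (Fin d)) :
    ∃ F, IsClassicalEquilibrium σ M E F ∧ ∀ v, 0 < F v := by
  obtain ⟨A, hA⟩ := K.exists_dampedTransport hM ‖E‖
  obtain ⟨F, hFM, hpos, hmass, hsol⟩ := K.exists_pos_solvesTransport (hA E le_rfl)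
  refine ⟨F, ⟨hFM, fun v => ?_, hmass⟩, hpos⟩
  rw [K.boltzmannQ_eq (hFM.integrable K.integrable_weight), hmass, smul_eq_mul δ, mul_one]
  exact hsol v

theorem isModifiedEquilibrium {E : EuclideanSpace ℝ (Fin d)} {F : EuclideanSpace ℝ (Fin d) → ℝ}
    (hF : IsClassicalEquilibrium σ M E F) : IsModifiedEquilibrium σ M E F := by
  have hFi := hF.isDominated.integrable K.integrable_weight
  exact
    { memLp := hF.isDominated.memLp_invWeight K.continuous_weight.measurable K.weight_pos
        K.integral_weight
      weak_eq := IsWeakLineDeriv.of_hasLineDerivAt hFi (K.integrable_boltzmannQ hFi)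
        hF.hasLineDerivAt
      mass := hF.mass }

theorem exists_isLinearResponse (hM : SubexponentialEquilibrium M) :
    ∃ lam, IsLinearResponse σ M lam := by
  obtain ⟨A, hA⟩ := K.exists_dampedTransport hM 0
  have hgrad := hM.isDominatedDiff_gradient
  obtain ⟨C, hC⟩ := hgrad.bound
  let s := BoundedContinuousFunction.ofNormedAddCommGroup (fun v => -((M v)⁻¹ • gradient M v))
    ((K.continuous_weight.inv₀ fun v => (K.weight_pos v).ne').smul
      hgrad.differentiable.continuous).neg C fun v => by
        have hMv := K.weight_pos v
        rw [norm_neg, norm_smul, norm_inv, Real.norm_eq_abs, abs_of_pos hMv,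
          inv_mul_le_iff₀ hMv, mul_comm]
        exact hC v
  have hs : ∀ v, M v • s v = -gradient M v := fun v =>
    (smul_neg _ _).trans (congrArg Neg.neg (smul_inv_smul₀ (K.weight_pos v).ne' _))
  obtain ⟨lam, hlamM, hsol⟩ := K.exists_solvesTransport (hA 0 norm_zero.le) s
  have hlami := hlamM.integrable K.integrable_weight
  have hmean : ∫ v, lam v = 0 := by
    have hmass := K.smul_integral_eq_of_solvesTransport hlami s.continuous s.norm_coe_le_norm hsol
    simp only [hs, integral_neg, hM.integral_gradient, neg_zero] at hmass
    exact (smul_eq_zero.1 hmass).resolve_left K.rate_pos.ne'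
  refine ⟨lam, hlamM, fun v => ?_, hmean⟩
  have hzero : M v • (s v + kernelIntegral volume (excess σ δ) lam v) -
      relaxationFreq volume (excess σ δ) M δ v • lam v = 0 :=
    (hsol v).unique hasLineDerivAt_zero
  rw [smul_add, hs] at hzero
  rw [K.boltzmannQ_eq hlami, hmean, smul_zero, zero_add, ← sub_eq_zero, ← hzero]
  abel

theorem isDominatedDiff_of_isLinearResponse (hM : SubexponentialEquilibrium M)
    (hσ : LipschitzCrossSection σ) {lam : EuclideanSpace ℝ (Fin d) → EuclideanSpace ℝ (Fin d)}
    (hlam : IsLinearResponse σ M lam) : IsDominatedDiff M lam := by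
  obtain ⟨C, hC⟩ := hσ.fderiv_bound
  have hk : ∀ v', Differentiable ℝ (excess σ δ v') := fun v' => (hσ.differentiable v').sub_const δ
  have hkC : ∀ v' v, ‖fderiv ℝ (excess σ δ v') v‖ ≤ C := fun v' v => by
    rw [show excess σ δ v' = fun v => σ v' v - δ from rfl, fderiv_sub_const]
    exact hC v' v
  have hlami := hlam.isDominated.integrable K.integrable_weight
  have hinv := (K.isDominatedDiff_relaxationFreq hk hkC).inv K.rate_pos K.le_relaxationFreq
  have hgain := hM.isDominatedDiff.smul (K.isDominatedDiff_kernelIntegral hk hkC hlami)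
  simp only [mul_one] at hgain
  have hprod := hinv.smul (hgain.sub hM.isDominatedDiff_gradient)
  simp only [one_mul] at hprod
  convert hprod using 2 with v
  rw [← hlam.boltzmannQ_eq, K.boltzmannQ_eq hlami, hlam.integral_eq_zero, smul_zero, zero_add,
    sub_sub_cancel, inv_smul_smul₀ (K.relaxationFreq_pos v).ne']

theorem isDominated_remainder {E : EuclideanSpace ℝ (Fin d)} {F : EuclideanSpace ℝ (Fin d) → ℝ}
    {lam : EuclideanSpace ℝ (Fin d) → EuclideanSpace ℝ (Fin d)}
    (hF : IsClassicalEquilibrium σ M E F) (hlam : IsLinearResponse σ M lam) :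
    IsDominated M fun v => F v - M v - inner ℝ E (lam v) :=
  (hF.isDominated.sub ⟨K.continuous_weight, 1, fun v => by
    rw [Real.norm_eq_abs, abs_of_pos (K.weight_pos v), one_mul]⟩).sub
    (hlam.isDominated.comp_continuousLinearMap (innerSL ℝ E))

theorem solvesTransport_remainder (hM : SubexponentialEquilibrium M)
    {E : EuclideanSpace ℝ (Fin d)} {F : EuclideanSpace ℝ (Fin d) → ℝ}
    {lam : EuclideanSpace ℝ (Fin d) → EuclideanSpace ℝ (Fin d)}
    (hF : IsClassicalEquilibrium σ M E F) (hlam : IsLinearResponse σ M lam)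
    (hlamd : Differentiable ℝ lam) :
    SolvesTransport (relaxationFreq volume (excess σ δ) M δ) E
      (fun v => F v - M v - inner ℝ E (lam v)) fun v =>
        M v * kernelIntegral volume (excess σ δ) (fun w => F w - M w - inner ℝ E (lam w)) v -
          inner ℝ E (fderiv ℝ lam v E) := by
  intro v
  have hFi := hF.isDominated.integrable K.integrable_weight
  have hlami := hlam.isDominated.integrable K.integrable_weight
  have hFMi : Integrable fun w => F w - M w := hFi.sub K.integrable_weight
  have hkernel : kernelIntegral volume (excess σ δ) (fun w => F w - M w - inner ℝ E (lam w)) v =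
      kernelIntegral volume (excess σ δ) F v - kernelIntegral volume (excess σ δ) M v -
        inner ℝ E (kernelIntegral volume (excess σ δ) lam v) := by
    rw [K.kernelIntegral_sub hFMi (hlami.const_inner E),
      K.kernelIntegral_sub hFi K.integrable_weight]
    exact congrArg _ (K.kernelIntegral_comp_continuousLinearMap (innerSL ℝ E) hlami v)
  have hM' := (hM.differentiable v).hasFDerivAt.hasLineDerivAt E
  have hlam' := ((innerSL ℝ E).hasFDerivAt.comp v (hlamd v).hasFDerivAt).hasLineDerivAt E
  refine (((hF.hasLineDerivAt v).sub hM').sub hlam').congr_deriv ?_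
  have hgrad : inner ℝ E (gradient M v) = fderiv ℝ M v E := by
    rw [inner_gradient_right, conj_trivial]
  have hQ := hlam.boltzmannQ_eq v
  rw [K.boltzmannQ_eq hlami, hlam.integral_eq_zero, smul_zero, zero_add] at hQ
  rw [K.boltzmannQ_eq hFi, hF.mass, ← hgrad, ← hQ]
  simp only [hkernel, relaxationFreq, inner_sub_right, inner_smul_right, smul_eq_mul,
    ContinuousLinearMap.comp_apply, innerSL_apply_apply]
  ring

theorem exists_abs_remainder_le (hM : SubexponentialEquilibrium M) (hσ : LipschitzCrossSection σ)
    {F : EuclideanSpace ℝ (Fin d) → EuclideanSpace ℝ (Fin d) → ℝ}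
    {lam : EuclideanSpace ℝ (Fin d) → EuclideanSpace ℝ (Fin d)}
    (hF : ∀ E, IsClassicalEquilibrium σ M E (F E)) (hlam : IsLinearResponse σ M lam) :
    ∃ C, 0 < C ∧ ∀ E, ‖E‖ ≤ 1 → ∀ v,
      |F E v - M v - inner ℝ E (lam v)| ≤ C * ‖E‖ ^ 2 * M v := by
  have hlamd := K.isDominatedDiff_of_isLinearResponse hM hσ hlam
  obtain ⟨A, hA⟩ := K.exists_dampedTransport hM 1
  obtain ⟨B, hB⟩ := hlamd.fderiv_bound
  have hbound : ∀ E, ‖E‖ ≤ 1 → ∀ v, |F E v - M v - inner ℝ E (lam v)| ≤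
      (B + β / δ * B) * A / (δ / 2) * ‖E‖ ^ 2 * M v := fun E hE v => by
    refine (K.norm_le_mul_weight (hA E hE) (κ := B * ‖E‖ ^ 2)
      (K.solvesTransport_remainder hM (hF E) hlam hlamd.differentiable)
      (K.isDominated_remainder (hF E) hlam) (fun w => ?_) v).trans_eq (by ring)
    have hMw := (K.weight_pos w).le
    have hD : ‖inner ℝ E (fderiv ℝ lam w E)‖ ≤ M w * (B * ‖E‖ ^ 2) :=
      calc ‖inner ℝ E (fderiv ℝ lam w E)‖ ≤ ‖E‖ * (‖fderiv ℝ lam w‖ * ‖E‖) :=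
            (norm_inner_le_norm _ _).trans (by gcongr; exact ContinuousLinearMap.le_opNorm _ _)
        _ ≤ ‖E‖ * (B * M w * ‖E‖) := by gcongr; exact hB w
        _ = M w * (B * ‖E‖ ^ 2) := by ring
    rw [mul_add, add_comm]
    refine (norm_sub_le _ _).trans (add_le_add ?_ hD)
    rw [norm_mul, Real.norm_of_nonneg hMw]
    exact mul_le_mul_of_nonneg_left (K.norm_kernelIntegral_le _ w) hMw
  refine ⟨|(B + β / δ * B) * A / (δ / 2)| + 1, by positivity, fun E hE v =>
    (hbound E hE v).trans ?_⟩
  have hMv := (K.weight_pos v).le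
  gcongr
  exact (le_abs_self _).trans (le_add_of_nonneg_right zero_le_one)

end ExcessKernel

end LinearResponse

theorem proposition2p3_general {d : ℕ}
    (M : EuclideanSpace ℝ (Fin d) → ℝ)
    (σ : EuclideanSpace ℝ (Fin d) → EuclideanSpace ℝ (Fin d) → ℝ)
    (hM : SubexponentialEquilibrium M) (hσ : LipschitzCrossSection σ) :
    ∃ (F : EuclideanSpace ℝ (Fin d) → EuclideanSpace ℝ (Fin d) → ℝ)
      (lam : EuclideanSpace ℝ (Fin d) → EuclideanSpace ℝ (Fin d))
      (G : EuclideanSpace ℝ (Fin d) → EuclideanSpace ℝ (Fin d) → ℝ),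
      (∀ E, IsModifiedEquilibrium σ M E (fun v => F v E) ∧
        Continuous (fun v => F v E) ∧ (∀ v, 0 < F v E) ∧
        ∀ f, IsModifiedEquilibrium σ M E f → f =ᵐ[volume] (fun v => F v E)) ∧
      (MemLp lam 2 (invWeight M) ∧ (∀ v, boltzmannQ σ M lam v = gradient M v) ∧
        ∫ v, lam v = 0 ∧
        ∀ l : EuclideanSpace ℝ (Fin d) → EuclideanSpace ℝ (Fin d),
          MemLp l 2 (invWeight M) → boltzmannQ σ M l =ᵐ[volume] gradient M →
          ∫ v, l v = 0 → l =ᵐ[volume] lam) ∧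
      (∀ v E, F v E = M v + inner ℝ E (lam v) + G v E) ∧
      ∃ C : ℝ, 0 < C ∧ ∀ E, ‖E‖ ≤ 1 →
        eLpNorm (fun v => G v E) 2 (invWeight M) ≤ ENNReal.ofReal (C * ‖E‖ ^ 2) ∧
        ∀ v, |G v E| ≤ C * ‖E‖ ^ 2 * M v := by
  obtain ⟨δ, β, K⟩ := hσ.exists_excessKernel hM
  have hMm := K.continuous_weight.measurable
  choose F hF hpos using K.exists_pos_isClassicalEquilibrium hM
  obtain ⟨lam, hlam⟩ := K.exists_isLinearResponse hM
  have hlami := hlam.isDominated.integrable K.integrable_weight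
  obtain ⟨C, hC, hG⟩ := K.exists_abs_remainder_le hM hσ hF hlam
  refine ⟨fun v E => F E v, lam, fun v E => F E v - M v - inner ℝ E (lam v),
    fun E => ⟨K.isModifiedEquilibrium (hF E), (hF E).isDominated.continuous, hpos E, fun f hf =>
      K.ae_eq_of_isModifiedEquilibrium hf (K.isModifiedEquilibrium (hF E))⟩,
    ⟨hlam.isDominated.memLp_invWeight hMm K.weight_pos K.integral_weight, hlam.boltzmannQ_eq,
      hlam.integral_eq_zero, fun l hl hQ hmean => ?_⟩,
    fun v E => by ring, C, hC, fun E hE =>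
      ⟨eLpNorm_invWeight_le hMm K.weight_pos K.integral_weight (hG E hE), hG E hE⟩⟩
  refine K.ae_eq_of_boltzmannQ_ae_eq
    (integrable_of_memLp_invWeight hMm K.weight_pos K.integrable_weight hl) hlami
    (hmean.trans hlam.integral_eq_zero.symm) ?_
  exact hQ.trans (Eventually.of_forall fun v => (hlam.boltzmannQ_eq v).symm)

theorem proposition2p3 {d : ℕ} (α : ℝ)
    (M : EuclideanSpace ℝ (Fin d) → ℝ)
    (σ : EuclideanSpace ℝ (Fin d) → EuclideanSpace ℝ (Fin d) → ℝ)
    (hM : HeavyTailEquilibrium α M) (hσ : AdmissibleCrossSection M σ) :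
    ∃ (F : EuclideanSpace ℝ (Fin d) → EuclideanSpace ℝ (Fin d) → ℝ)
      (lam : EuclideanSpace ℝ (Fin d) → EuclideanSpace ℝ (Fin d))
      (G : EuclideanSpace ℝ (Fin d) → EuclideanSpace ℝ (Fin d) → ℝ),
      -- `F(·, E)` is the continuous representative of the unique solution, and it is positive
      (∀ E, IsModifiedEquilibrium σ M E (fun v => F v E) ∧
        Continuous (fun v => F v E) ∧ (∀ v, 0 < F v E) ∧
        ∀ f, IsModifiedEquilibrium σ M E f → f =ᵐ[volume] (fun v => F v E)) ∧
      -- `lam` is the unique solution of `Q(lam) = ∇M` of mean zero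
      (MemLp lam 2 (invWeight M) ∧ (∀ v, boltzmannQ σ M lam v = gradient M v) ∧
        ∫ v, lam v = 0 ∧
        ∀ l : EuclideanSpace ℝ (Fin d) → EuclideanSpace ℝ (Fin d),
          MemLp l 2 (invWeight M) → boltzmannQ σ M l =ᵐ[volume] gradient M →
          ∫ v, l v = 0 → l =ᵐ[volume] lam) ∧
      -- the expansion and the two bounds on the remainder
      (∀ v E, F v E = M v + inner ℝ E (lam v) + G v E) ∧
      ∃ C : ℝ, 0 < C ∧ ∀ E, ‖E‖ ≤ 1 →
        eLpNorm (fun v => G v E) 2 (invWeight M) ≤ ENNReal.ofReal (C * ‖E‖ ^ 2) ∧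
        ∀ v, |G v E| ≤ C * ‖E‖ ^ 2 * M v :=
  proposition2p3_general M σ hM.subexponentialEquilibrium hσ.lipschitzCrossSection
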